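/- **The problem.** An arena consists of a finite set $S$ of states, an initial state $s_0\in S$, a finite set of players $\{1,\dots,n\}$, a partition $S=S_1\uplus\dots\uplus S_n$ (player $i$ controls the states of $S_i$), an edge relation $E\subseteq S\times S$ such that every state has at least one successor, and a labelling $\ell$ of the states by finite sets of atomic propositions. A play is an infinite path that starts in $s_0$; a history is a nonempty finite prefix of a play. A strategy of player $i$ maps every history that ends in a state $s\in S_i$ to a state $s'$ with $(s,s')\in E$. A strategy profile $\sigma=(\sigma_1,\dots,\sigma_n)$ has a unique outcome $\mathrm{out}(\sigma)$, the play that is compatible with all $\sigma_i$; $(\sigma_{-i},\sigma_i')$ denotes $\sigma$ with $\sigma_i$ replaced by $\sigma_i'$. Let $\overline{\mathrm{cost}}:E\to\mathbb Z^d$ be a cost function for $d$ resources. $\mathsf{MultiEnergy}$ is the set of plays $\pi_0\pi_1\pi_2\cdots$ such that $\sum_{k<i}\overline{\mathrm{cost}}(\pi_k,\pi_{k+1})\ge(0,\dots,0)$ componentwise for all $i\ge 0$. Let $\mathsf{Obj}_1,\dots,\mathsf{Obj}_n$ (the players' objectives) and $\mathsf{Obj}$ (the global objective) be sets of plays, each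 given by a formula of linear-time temporal logic (LTL) over the atomic propositions. A solution of the careful cooperative rational synthesis problem is a strategy profile $\sigma$ such that $\mathrm{out}(\sigma)\in\mathsf{MultiEnergy}\cap\mathsf{Obj}$ and, for every player $i$ and every strategy $\sigma_i'$ of player $i$, $$\mathrm{out}(\sigma_{-i},\sigma_i')\in\mathsf{Obj}_i\cap\mathsf{MultiEnergy}\ \Longrightarrow\ \mathrm{out}(\sigma)\in\mathsf{Obj}_i .$$ An instance of the problem consists of an arena, a cost function and LTL formulas for the objectives, presented by a finite description; the question is whether there is a solution. A reachability objective is one of the form $\Diamond\alpha$ with $\alpha$ an atomic proposition, i.e. the set of plays that visit some state labelled with $\alpha$. **Theorem.** The careful cooperative rational synthesis problem is undecidable: no computable function answers it correctly on the descriptions of all instances. It remains undecidable when restricted to the instances with two players and two resources in which the objectives of both players and the global objective are reachability objectives. -/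

import Mathlib

namespace CarefulSynthesis

/-! ## Arenas, plays and strategies -/

/-- A multi-player arena with states `S`, players `P` and atomic propositions `AP`.
The partition of the states is given by the function `owner`. Every state has a successor. -/
structure Arena (S P AP : Type) where
  init : S
  owner : S → P
  edge : S → S → Prop
  label : S → Set AP
  serial : ∀ s, ∃ t, edge s t

/-- The prefix `π 0, …, π k` of an infinite sequence. -/
def playPrefix {S : Type} (π : ℕ → S) (k : ℕ) : List S := (List.range (k + 1)).map π

theorem getLast?_playPrefix {S : Type} (π : ℕ → S) (k : ℕ) :
    (playPrefix π k).getLast? = some (π k) := by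
  simp [playPrefix, List.range_succ]

theorem playPrefix_congr {S : Type} {π π' : ℕ → S} {k : ℕ} (h : ∀ j ≤ k, π j = π' j) :
    playPrefix π k = playPrefix π' k := by
  simp only [playPrefix, List.map_inj_left, List.mem_range]
  exact fun j hj => h j (by omega)

namespace Arena

variable {S P AP : Type} (A : Arena S P AP)

/-- The infinite paths that start in the initial state. -/
def plays : Set (ℕ → S) := {π | π 0 = A.init ∧ ∀ i, A.edge (π i) (π (i + 1))}

/-- Histories: the (nonempty) finite prefixes of plays. -/
def hist : Set (List S) := {h | ∃ π ∈ A.plays, ∃ k, h = playPrefix π k}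

/-- Histories whose last state is controlled by player `i`. -/
def histOf (i : P) : Set (List S) :=
  {h | h ∈ A.hist ∧ ∃ s, h.getLast? = some s ∧ A.owner s = i}

/-- A strategy of player `i`. -/
structure Strategy (i : P) where
  move : A.histOf i → S
  legal : ∀ (h : A.histOf i) (s : S), h.1.getLast? = some s → A.edge s (move h)

/-- The plays that are compatible with the strategy `σ` of player `i`. -/
def out {i : P} (σ : A.Strategy i) : Set (ℕ → S) :=
  {π | π ∈ A.plays ∧ ∀ (j : ℕ) (hj : playPrefix π j ∈ A.histOf i),
    σ.move ⟨playPrefix π j, hj⟩ = π (j + 1)}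

/-- A strategy profile: one strategy for each player. -/
abbrev Profile := ∀ i : P, A.Strategy i

/-- A play that is compatible with every strategy of the profile. -/
def IsOutcome (σ : A.Profile) (π : ℕ → S) : Prop :=
  π ∈ A.plays ∧ ∀ i, π ∈ A.out (σ i)

variable {A}

theorem exists_path (s : S) : ∃ ρ : ℕ → S, ρ 0 = s ∧ ∀ i, A.edge (ρ i) (ρ (i + 1)) := by
  choose f hf using A.serial
  refine ⟨fun n => f^[n] s, rfl, fun i => ?_⟩
  simpa only [Function.iterate_succ_apply'] using hf (f^[i] s)

theorem exists_extension {π : ℕ → S} (hπ : π ∈ A.plays) (k : ℕ) {t : S}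
    (ht : A.edge (π k) t) :
    ∃ π' ∈ A.plays, (∀ j ≤ k, π' j = π j) ∧ π' (k + 1) = t := by
  obtain ⟨ρ, h0, hρ⟩ := A.exists_path t
  refine ⟨fun n => if n ≤ k then π n else ρ (n - (k + 1)), ⟨?_, fun i => ?_⟩, ?_, ?_⟩
  · simpa using hπ.1
  · rcases lt_trichotomy i k with h | h | h
    · simpa [h.le, Nat.succ_le_of_lt h] using hπ.2 i
    · subst h
      simpa [h0] using ht
    · have h1 : ¬ i ≤ k := by omega
      have h2 : ¬ i + 1 ≤ k := by omega
      have h3 : i + 1 - (k + 1) = i - (k + 1) + 1 := by omega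
      simp only [h1, h2, if_false, h3]
      exact hρ _
  · intro j hj
    simp [hj]
  · simp [h0]

theorem playPrefix_mem_histOf {π : ℕ → S} (hπ : π ∈ A.plays) (k : ℕ) :
    playPrefix π k ∈ A.histOf (A.owner (π k)) :=
  ⟨⟨π, hπ, k, rfl⟩, π k, getLast?_playPrefix π k, rfl⟩

/-- A strategy profile has exactly one outcome. -/
theorem existsUnique_isOutcome (σ : A.Profile) : ∃! π, A.IsOutcome σ π := by
  have step : ∀ (n : ℕ) (p : A.plays), ∃ q : A.plays, (∀ j ≤ n, q.1 j = p.1 j) ∧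
      q.1 (n + 1) = (σ (A.owner (p.1 n))).move ⟨_, playPrefix_mem_histOf p.2 n⟩ := by
    intro n p
    obtain ⟨q, hq, h1, h2⟩ := exists_extension p.2 n
      ((σ (A.owner (p.1 n))).legal ⟨_, playPrefix_mem_histOf p.2 n⟩ _ (getLast?_playPrefix _ _))
    exact ⟨⟨q, hq⟩, h1, h2⟩
  choose f hf1 hf2 using step
  obtain ⟨ρ, hρ⟩ := A.exists_path A.init
  let F : ℕ → A.plays := fun n => Nat.rec ⟨ρ, hρ⟩ f n
  have hF : ∀ n, F (n + 1) = f n (F n) := fun n => rfl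
  have agree : ∀ n j, j ≤ n → (F n).1 j = (F j).1 j := by
    intro n
    induction n with
    | zero => intro j hj; obtain rfl : j = 0 := by omega
              rfl
    | succ n ih =>
      intro j hj
      rcases Nat.lt_or_ge n j with h | h
      · obtain rfl : j = n + 1 := by omega
        rfl
      · rw [hF, hf1 n _ j h, ih j h]
  have hpre : ∀ k, playPrefix (fun n => (F n).1 n) k = playPrefix (F k).1 k :=
    fun k => playPrefix_congr fun j hj => (agree k j hj).symm
  have key : ∀ (i : P) (k : ℕ) (h : List S) (hh : h ∈ A.histOf i),
      h = playPrefix (F k).1 k → (σ i).move ⟨h, hh⟩ = (F (k + 1)).1 (k + 1) := by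
    rintro i k h hh rfl
    obtain ⟨-, s, hs, rfl⟩ := id hh
    rw [getLast?_playPrefix] at hs
    obtain rfl := Option.some.inj hs
    rw [hF, hf2]
  have hplay : (fun n => (F n).1 n) ∈ A.plays := by
    refine ⟨(F 0).2.1, fun i => ?_⟩
    have := (F (i + 1)).2.2 i
    rwa [agree (i + 1) i (by omega)] at this
  refine ⟨fun n => (F n).1 n, ⟨hplay, fun i => ⟨hplay, fun j hj => key i j _ hj (hpre j)⟩⟩, ?_⟩
  rintro π ⟨hπ, hσ⟩
  have main : ∀ n, ∀ j ≤ n, π j = (F j).1 j := by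
    intro n
    induction n with
    | zero =>
      intro j hj
      obtain rfl : j = 0 := by omega
      exact hπ.1.trans (F 0).2.1.symm
    | succ n ih =>
      intro j hj
      rcases Nat.lt_or_ge n j with h | h
      · obtain rfl : j = n + 1 := by omega
        rw [← (hσ _).2 n (playPrefix_mem_histOf hπ n)]
        exact key _ n _ _ ((playPrefix_congr ih).trans (hpre n))
      · exact ih j h
  funext n
  exact main n n le_rfl

variable (A)

/-- The unique outcome of a strategy profile. -/
noncomputable def outcome (σ : A.Profile) : ℕ → S := (existsUnique_isOutcome σ).choose

theorem outcome_spec (σ : A.Profile) : A.IsOutcome σ (A.outcome σ) :=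
  (existsUnique_isOutcome σ).choose_spec.1

/-! ## Resources and careful rational synthesis -/

/-- The plays along which no resource ever becomes negative, where all resources start at `0`
and traversing the edge from `s` to `t` changes resource `r` by `cost s t r`. -/
def multiEnergy {d : ℕ} (cost : S → S → Fin d → ℤ) : Set (ℕ → S) :=
  {π | π ∈ A.plays ∧ ∀ (i : ℕ) (r : Fin d),
    0 ≤ ∑ k ∈ Finset.range i, cost (π k) (π (k + 1)) r}

/-- The profile `σ` solves the careful cooperative rational synthesis problem for the costs `cost`,
the players' objectives `obj` and the global objective `spec`. -/
def IsSolution [DecidableEq P] {d : ℕ} (cost : S → S → Fin d → ℤ) (obj : P → Set (ℕ → S))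
    (spec : Set (ℕ → S)) (σ : A.Profile) : Prop :=
  A.outcome σ ∈ A.multiEnergy cost ∩ spec ∧
    ∀ (i : P) (σ' : A.Strategy i),
      A.outcome (Function.update σ i σ') ∈ obj i ∩ A.multiEnergy cost → A.outcome σ ∈ obj i

end Arena

/-! ## Linear-time temporal logic -/

/-- Formulas of linear-time temporal logic. -/
inductive LTL (AP : Type) : Type where
  | atom (a : AP) : LTL AP
  | neg (φ : LTL AP) : LTL AP
  | disj (φ ψ : LTL AP) : LTL AP
  | next (φ : LTL AP) : LTL AP
  | untl (φ ψ : LTL AP) : LTL AP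

namespace LTL

/-- Satisfaction of a formula by an infinite sequence of labelled states. -/
def Sat {S AP : Type} (label : S → Set AP) : LTL AP → (ℕ → S) → Prop
  | atom a, ρ => a ∈ label (ρ 0)
  | neg φ, ρ => ¬ Sat label φ ρ
  | disj φ ψ, ρ => Sat label φ ρ ∨ Sat label ψ ρ
  | next φ, ρ => Sat label φ (fun k => ρ (1 + k))
  | untl φ ψ, ρ => ∃ i, Sat label ψ (fun k => ρ (i + k)) ∧
      ∀ j < i, Sat label φ (fun k => ρ (j + k))

/-- `◇ φ`, that is `True U φ`, with `True` written as `φ ∨ ¬ φ`. -/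
def eventually {AP : Type} (φ : LTL AP) : LTL AP := untl (disj φ (neg φ)) φ

/-- A reachability objective: some state labelled with the proposition `a` is visited. -/
def IsReachability {AP : Type} (φ : LTL AP) : Prop := ∃ a : AP, φ = eventually (atom a)

/-- A numbering of the formulas over the propositions `0, 1, 2, …`. -/
def code : LTL ℕ → ℕ
  | atom a => 5 * a
  | neg φ => 5 * φ.code + 1
  | disj φ ψ => 5 * Nat.pair φ.code ψ.code + 2
  | next φ => 5 * φ.code + 3
  | untl φ ψ => 5 * Nat.pair φ.code ψ.code + 4

theorem code_injective : Function.Injective code := by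
  intro φ
  induction φ with
  | atom a => intro ψ h; cases ψ <;> simp only [code] at h <;> first | omega | (congr 1; omega)
  | neg φ ih =>
    intro ψ h; cases ψ <;> simp only [code] at h <;> first | omega | (congr 1; exact ih (by omega))
  | next φ ih =>
    intro ψ h; cases ψ <;> simp only [code] at h <;> first | omega | (congr 1; exact ih (by omega))
  | disj φ χ ih1 ih2 =>
    intro ψ h
    cases ψ <;> simp only [code] at h <;> try omega
    obtain ⟨h1, h2⟩ := Nat.pair_eq_pair.1 (Nat.eq_of_mul_eq_mul_left (by norm_num)
      (Nat.add_right_cancel h))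
    rw [ih1 h1, ih2 h2]
  | untl φ χ ih1 ih2 =>
    intro ψ h
    cases ψ <;> simp only [code] at h <;> try omega
    obtain ⟨h1, h2⟩ := Nat.pair_eq_pair.1 (Nat.eq_of_mul_eq_mul_left (by norm_num)
      (Nat.add_right_cancel h))
    rw [ih1 h1, ih2 h2]

end LTL

/-! ## Instances of the decision problem -/

/-- An instance with `n` players and `d` resources: a finite arena with states `0, …, N - 1`,
labelled by finite sets of propositions from `ℕ`, with costs and LTL objectives. Only the costs of
pairs of states that are joined by an edge matter. -/
structure Instance (n d : ℕ) where
  N : ℕ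
  init : Fin N
  owner : Fin N → Fin n
  edge : Fin N → Fin N → Bool
  serial : ∀ s, ∃ t, edge s t = true
  label : Fin N → Finset ℕ
  cost : Fin N → Fin N → Fin d → ℤ
  obj : Fin n → LTL ℕ
  spec : LTL ℕ

namespace Instance

variable {n d : ℕ} (I : Instance n d)

/-- The arena of an instance. -/
def arena : Arena (Fin I.N) (Fin n) ℕ where
  init := I.init
  owner := I.owner
  edge s t := I.edge s t = true
  label s := ↑(I.label s)
  serial := I.serial

/-- The set of plays that satisfy the formula `φ`. -/
def objective (φ : LTL ℕ) : Set (ℕ → Fin I.N) :=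
  {π | π ∈ I.arena.plays ∧ φ.Sat I.arena.label π}

/-- The careful cooperative rational synthesis problem has a solution. -/
def HasSolution : Prop :=
  ∃ σ : I.arena.Profile,
    I.arena.IsSolution I.cost (fun i => I.objective (I.obj i)) (I.objective I.spec) σ

/-- All players' objectives and the global objective are reachability objectives. -/
def ReachabilityObjectives : Prop :=
  (∀ i, (I.obj i).IsReachability) ∧ I.spec.IsReachability

end Instance

/-- Finite descriptions of instances: the numbers of players, resources and states, the initial
state, the table of owners, the table of labels, the matrix of edges and costs, the numbers of the
players' objectives and of the global objective. -/
abbrev Description : Type :=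
  ℕ × ℕ × ℕ × ℕ × List ℕ × List (List ℕ) × List (List (Bool × List ℤ)) × List ℕ × ℕ

/-- The description of an instance. -/
def Instance.describe {n d : ℕ} (I : Instance n d) : Description :=
  (n, d, I.N, I.init.val, List.ofFn fun s => (I.owner s).val,
    List.ofFn fun s => (I.label s).sort (· ≤ ·),
    List.ofFn fun s => List.ofFn fun t => (I.edge s t, List.ofFn (I.cost s t)),
    List.ofFn fun i => (I.obj i).code, I.spec.code)

theorem Instance.describe_injective {n d : ℕ} :
    Function.Injective (Instance.describe : Instance n d → Description) := by
  rintro ⟨N, i, o, e, hs, l, c, b, p⟩ ⟨N', i', o', e', hs', l', c', b', p'⟩ h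
  simp only [Instance.describe, Prod.mk.injEq, true_and] at h
  obtain ⟨rfl, h1, h2, h3, h4, h5, h6⟩ := h
  simp only [List.ofFn_inj, funext_iff, Prod.mk.injEq] at h2 h3 h4 h5
  obtain rfl : i = i' := Fin.ext h1
  obtain rfl : o = o' := funext fun s => Fin.ext (h2 s)
  obtain rfl : l = l' := funext fun s => by
    rw [← Finset.sort_toFinset (l s) (· ≤ ·), h3 s, Finset.sort_toFinset]
  obtain rfl : e = e' := funext fun s => funext fun t => (h4 s t).1
  obtain rfl : c = c' := funext fun s => funext fun t => funext ((h4 s t).2)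
  obtain rfl : b = b' := funext fun s => LTL.code_injective (h5 s)
  obtain rfl : p = p' := LTL.code_injective h6
  rfl

/-- A problem `p` on objects of type `α`, presented by descriptions in `β`, is decidable if some
computable function answers it correctly on the description of every object. -/
def DecidableProblem {α β : Type} [Primcodable β] (describe : α → β) (p : α → Prop) : Prop :=
  ∃ f : β → Bool, Computable f ∧ ∀ a, f (describe a) = true ↔ p a

end CarefulSynthesis

/-!
The halting problem is reduced to the existence of a solution. The instances that arise have two
players, two resources and reachability objectives, so that one reduction serves for both claims.

The two resources are the counters of a counter machine (`Automaton`), and the arena is its control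
graph. The condition `MultiEnergy` says that no counter becomes negative, and the global objective
asks to reach a sink `halt`. What is left is to enforce zero tests. A state that claims that counter
`r` is zero belongs to player `1`, who may leave it to a sink `trap` at the price of one unit of
`r`. The objective of player `1` is to reach `trap`. If the claim is wrong, then this deviation is
affordable and profitable, since a play that reaches `halt` never visits `trap`; if the claim is
right, then the deviation violates `MultiEnergy` and does not count. Hence the solutions are the
halting runs in which all zero tests are correct (`CounterGame.exists_isSolution_iff`,
`Automaton.toInstance_hasSolution_iff`). Nondeterminism of the machine is harmless, because only the
existence of a run matters.

Two counters suffice for universal computation. It is convenient to describe programs by the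
relations they compute: `Regular B` is the closure of a set `B` of basic instructions under
composition, iteration and finite unions. Every regular program with two counters is executed by an
automaton (`Regular.exists_automaton`). Programs with arbitrarily many registers are simulated by
keeping in one counter the product of the prime powers whose exponents are the register contents;
the second counter serves to multiply, to divide and to test for divisibility
(`RegisterProgram.exists_simulates`). Finally, register programs compute all partial recursive
functions, by induction on Mathlib's basis `Nat.Partrec'` (`computes_of_partrec`).

Applied to a universal function, this yields a single automaton that halts from the counter values
`2 ^ n` and `0` if and only if the `n`-th program halts (`exists_universal_automaton`). The number
`2 ^ n` is loaded by the cost of the first edge of the arena. So the instances for different `n`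
differ in one entry of the cost matrix only, and their descriptions are a computable function of
`n`.
-/

namespace CarefulSynthesis

/-! ### Games that check zero tests by deviations -/

namespace Arena

variable {S P AP : Type} (A : Arena S P AP)

theorem outcome_eq {σ : A.Profile} {π : ℕ → S} (h : A.IsOutcome σ π) : A.outcome σ = π :=
  (existsUnique_isOutcome σ).unique (A.outcome_spec σ) h

variable {A}

theorem exists_edge_of_histOf {i : P} (h : A.histOf i) :
    ∃ t, ∀ s, h.1.getLast? = some s → A.edge s t := by
  obtain ⟨s, hs, -⟩ := h.2.2
  obtain ⟨t, ht⟩ := A.serial s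
  exact ⟨t, fun s' hs' => by rw [hs] at hs'; cases hs'; exact ht⟩

open Classical in
/-- The strategy that continues along the play `π` on the prefixes of `π`, and makes an arbitrary
legal move elsewhere. -/
noncomputable def follow {π : ℕ → S} (hπ : π ∈ A.plays) (i : P) : A.Strategy i where
  move h := if h.1 = playPrefix π (h.1.length - 1) then π h.1.length
    else (exists_edge_of_histOf h).choose
  legal h s hs := by
    split_ifs with hh
    · obtain ⟨⟨ρ, hρ, k, hk⟩, -⟩ := h.2
      have hl : h.1.length = k + 1 := by rw [hk]; simp [playPrefix]
      rw [hl] at hh ⊢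
      rw [hh, Nat.add_sub_cancel, getLast?_playPrefix] at hs
      cases hs
      exact hπ.2 k
    · exact (exists_edge_of_histOf h).choose_spec s hs

theorem follow_move {π : ℕ → S} (hπ : π ∈ A.plays) (i : P) (k : ℕ)
    (hk : playPrefix π k ∈ A.histOf i) :
    (follow hπ i).move ⟨playPrefix π k, hk⟩ = π (k + 1) := by
  have hl : (playPrefix π k).length = k + 1 := by simp [playPrefix]
  simp [follow, hl]

theorem follow_outcome {π : ℕ → S} (hπ : π ∈ A.plays) :
    A.outcome (fun i => follow hπ i) = π :=
  outcome_eq A ⟨hπ, fun i => ⟨hπ, fun k hk => follow_move hπ i k hk⟩⟩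

theorem owner_of_playPrefix_mem {π : ℕ → S} {i : P} {k : ℕ} (h : playPrefix π k ∈ A.histOf i) :
    A.owner (π k) = i := by
  obtain ⟨-, s, hs, hi⟩ := h
  rw [getLast?_playPrefix] at hs
  cases hs
  exact hi

end Arena

/-- The level of resource `r` after the first `k` edges of `π`. -/
def level {S : Type} {d : ℕ} (cost : S → S → Fin d → ℤ) (π : ℕ → S) (k : ℕ) (r : Fin d) : ℤ :=
  ∑ j ∈ Finset.range k, cost (π j) (π (j + 1)) r

section level

variable {S : Type} {d : ℕ} {cost : S → S → Fin d → ℤ} {π π' : ℕ → S}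

theorem level_zero (r : Fin d) : level cost π 0 r = 0 := rfl

theorem level_succ (k : ℕ) (r : Fin d) :
    level cost π (k + 1) r = level cost π k r + cost (π k) (π (k + 1)) r :=
  Finset.sum_range_succ _ _

theorem level_congr {k : ℕ} (h : ∀ j ≤ k, π j = π' j) (r : Fin d) :
    level cost π k r = level cost π' k r := by
  refine Finset.sum_congr rfl fun j hj => ?_
  have := Finset.mem_range.1 hj
  rw [h j (by omega), h (j + 1) (by omega)]

end level

/-- An arena for two players in which player `0` runs a program with counters and player `1` checks
its zero tests. The states `halt` and `trap` are sinks. A state `s` with `test s = some r` claims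
that resource `r` is used up. It belongs to player `1`, who can either make the only regular move
or go to `trap` at the price of one unit of `r`, which is affordable exactly if the claim is
wrong. -/
structure CounterGame {S : Type} (A : Arena S (Fin 2) ℕ) (cost : S → S → Fin 2 → ℤ) where
  halt : S
  trap : S
  test : S → Option (Fin 2)
  halt_edge : ∀ t, A.edge halt t → t = halt
  trap_edge : ∀ t, A.edge trap t → t = trap
  halt_cost : cost halt halt = 0
  trap_cost : cost trap trap = 0
  halt_ne_trap : halt ≠ trap
  init_ne_trap : A.init ≠ trap
  test_of_owner : ∀ s, s ≠ trap → A.owner s = 1 → ∃ r, test s = some r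
  owner_of_test : ∀ s r, test s = some r → A.owner s = 1
  edge_of_test : ∀ s r, test s = some r → A.edge s trap
  cost_of_test : ∀ s r, test s = some r → cost s trap = -Pi.single r 1
  eq_of_test : ∀ s r t t', test s = some r → A.edge s t → A.edge s t' → t ≠ trap → t' ≠ trap →
    t = t'

namespace CounterGame

variable {S : Type} {A : Arena S (Fin 2) ℕ} {cost : S → S → Fin 2 → ℤ} (G : CounterGame A cost)

/-- A regular move between states with resource levels, which respects the zero tests. -/
def Move (x y : S × (Fin 2 → ℕ)) : Prop :=
  A.edge x.1 y.1 ∧ y.1 ≠ G.trap ∧ (∀ r, G.test x.1 = some r → x.2 r = 0) ∧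
    ∀ r, (y.2 r : ℤ) = x.2 r + cost x.1 y.1 r

include G

theorem halt_forever {π : ℕ → S} (hπ : π ∈ A.plays) {k m : ℕ} (h : π k = G.halt) (hm : k ≤ m) :
    π m = G.halt := by
  induction m, hm using Nat.le_induction with
  | base => exact h
  | succ m _ ih => exact G.halt_edge _ (ih ▸ hπ.2 m)

theorem trap_forever {π : ℕ → S} (hπ : π ∈ A.plays) {k m : ℕ} (h : π k = G.trap) (hm : k ≤ m) :
    π m = G.trap := by
  induction m, hm using Nat.le_induction with
  | base => exact h
  | succ m _ ih => exact G.trap_edge _ (ih ▸ hπ.2 m)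

theorem ne_trap_of_halt {π : ℕ → S} (hπ : π ∈ A.plays) {k : ℕ} (h : π k = G.halt) (m : ℕ) :
    π m ≠ G.trap := by
  intro hm
  rcases le_total k m with hk | hk
  · exact G.halt_ne_trap ((G.halt_forever hπ h hk).symm.trans hm)
  · exact G.halt_ne_trap (h.symm.trans (G.trap_forever hπ hm hk))

theorem test_halt (r : Fin 2) : G.test G.halt ≠ some r := fun h =>
  G.halt_ne_trap (G.halt_edge _ (G.edge_of_test _ r h)).symm

/-- If the outcome of a profile meets a state that wrongly claims that resource `r` is used up,
then player `1` has an affordable deviation that reaches `trap`. -/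
theorem exists_deviation (σ : A.Profile) {k : ℕ} {r : Fin 2}
    (hen : A.outcome σ ∈ A.multiEnergy cost) (htest : G.test (A.outcome σ k) = some r)
    (hpos : level cost (A.outcome σ) k r ≠ 0) :
    ∃ σ' : A.Strategy 1, A.outcome (Function.update σ 1 σ') ∈ A.multiEnergy cost ∧
      ∃ m, A.outcome (Function.update σ 1 σ') m = G.trap := by
  -- The deviation follows the outcome up to step `k` and then moves to `trap`.
  obtain ⟨hπ, hσ⟩ := A.outcome_spec σ
  set π := A.outcome σ with hπdef
  let π' : ℕ → S := fun j => if j ≤ k then π j else G.trap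
  have hagree : ∀ j ≤ k, π' j = π j := fun j hj => if_pos hj
  have htrap : ∀ j, k < j → π' j = G.trap := fun j hj => if_neg (by omega)
  obtain ⟨t, ht⟩ := A.serial G.trap
  have ht' : A.edge G.trap G.trap := by
    have := G.trap_edge t ht
    rwa [this] at ht
  have hplay : π' ∈ A.plays := by
    refine ⟨(hagree 0 (Nat.zero_le _)).trans hπ.1, fun j => ?_⟩
    rcases lt_trichotomy j k with h | h | h
    · rw [hagree j h.le, hagree (j + 1) h]
      exact hπ.2 j
    · subst h
      rw [hagree j le_rfl, htrap (j + 1) (by omega)]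
      exact G.edge_of_test _ r htest
    · rw [htrap j h, htrap (j + 1) (by omega)]
      exact ht'
  have hout : A.outcome (Function.update σ 1 (Arena.follow hplay 1)) = π' := by
    refine A.outcome_eq ⟨hplay, fun i => ?_⟩
    rcases eq_or_ne i 1 with rfl | hi
    · rw [Function.update_self]
      exact ⟨hplay, fun j hj => Arena.follow_move hplay 1 j hj⟩
    · rw [Function.update_of_ne hi]
      refine ⟨hplay, fun j hj => ?_⟩
      have hown := Arena.owner_of_playPrefix_mem hj
      rcases lt_trichotomy j k with h | h | h
      · have hpre : playPrefix π' j = playPrefix π j :=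
          playPrefix_congr fun l hl => hagree l (by omega)
        rw [hagree (j + 1) h, ← (hσ i).2 j (hpre ▸ hj)]
        exact congrArg (σ i).move (Subtype.ext hpre)
      · subst h
        rw [hagree j le_rfl, G.owner_of_test _ r htest] at hown
        exact absurd hown.symm hi
      · rw [htrap (j + 1) (by omega)]
        refine G.trap_edge _ ((σ i).legal ⟨_, hj⟩ _ ?_)
        rw [getLast?_playPrefix, htrap j h]
  have hlev : ∀ j s,
      level cost π' (k + 1 + j) s = level cost π k s - (Pi.single r 1 : Fin 2 → ℤ) s := by
    intro j s
    induction j with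
    | zero =>
      rw [Nat.add_zero, level_succ, level_congr hagree, hagree k le_rfl,
        htrap (k + 1) (by omega), G.cost_of_test _ r htest]
      simp [sub_eq_add_neg]
    | succ j ih =>
      rw [← Nat.add_assoc, level_succ, ih, htrap (k + 1 + j) (by omega),
        htrap (k + 1 + j + 1) (by omega), G.trap_cost]
      simp
  refine ⟨Arena.follow hplay 1, ?_⟩
  rw [hout]
  refine ⟨⟨hplay, fun j s => ?_⟩, k + 1, htrap _ (by omega)⟩
  change 0 ≤ level cost π' j s
  rcases Nat.lt_or_ge k j with h | h
  · obtain ⟨j, rfl⟩ := Nat.exists_eq_add_of_le (Nat.succ_le_of_lt h)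
    rw [Nat.succ_eq_add_one, hlev]
    have h1 : 0 ≤ level cost π k s := hen.2 k s
    rcases eq_or_ne s r with rfl | hs
    · rw [Pi.single_eq_same]
      omega
    · rw [Pi.single_eq_of_ne hs]
      omega
  · rw [level_congr (k := j) (π' := π) fun l hl => hagree l (by omega)]
    exact hen.2 j s

/-- A sequence of regular moves is realised by the beginning of a play. -/
theorem exists_play {x : S × (Fin 2 → ℕ)}
    (h : Relation.ReflTransGen G.Move (A.init, 0) x) :
    ∃ π ∈ A.plays, ∃ T, π T = x.1 ∧ (∀ r, level cost π T r = x.2 r) ∧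
      (∀ k ≤ T, ∀ r, 0 ≤ level cost π k r) ∧
      ∀ k < T, ∀ r, G.test (π k) = some r → level cost π k r = 0 := by
  induction h with
  | refl =>
    obtain ⟨π, h0, hπ⟩ := A.exists_path A.init
    refine ⟨π, ⟨h0, hπ⟩, 0, h0, fun r => ?_, fun k hk r => ?_, fun k hk => ?_⟩
    · simp [level_zero]
    · obtain rfl : k = 0 := by omega
      exact (level_zero r).ge
    · omega
  | @tail y z _ hyz ih =>
    obtain ⟨π, hπ, T, hT, hlev, hnn, hz⟩ := ih
    obtain ⟨hedge, -, htest, hcost⟩ := hyz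
    obtain ⟨π', hπ', hagree, hnext⟩ := Arena.exists_extension hπ T (hT ▸ hedge)
    have hlev' : ∀ k ≤ T, ∀ r, level cost π' k r = level cost π k r := fun k hk r =>
      level_congr (fun j hj => hagree j (by omega)) r
    have hlast : ∀ r, level cost π' (T + 1) r = z.2 r := fun r => by
      rw [level_succ, hlev' T le_rfl, hlev, hcost, hagree T le_rfl, hT, hnext]
    refine ⟨π', hπ', T + 1, hnext, hlast, fun k hk r => ?_, fun k hk r hr => ?_⟩
    · rcases Nat.lt_or_ge T k with h | h
      · obtain rfl : k = T + 1 := by omega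
        rw [hlast]
        positivity
      · rw [hlev' k h]
        exact hnn k h r
    · have hkT : k ≤ T := by omega
      rw [hagree k hkT] at hr
      rw [hlev' k hkT]
      rcases hkT.eq_or_lt with rfl | h
      · rw [hlev, htest r (hT ▸ hr)]
        rfl
      · exact hz k h r hr

/-- Along a play that stays affordable until it reaches `halt` and along which all zero tests are
correct, player `1` has no profitable deviation. -/
theorem not_exists_deviation {π : ℕ → S} (hπ : π ∈ A.plays) {T : ℕ} (hT : π T = G.halt)
    (hz : ∀ k < T, ∀ r, G.test (π k) = some r → level cost π k r = 0)
    (σ' : A.Strategy 1)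
    (hen : A.outcome (Function.update (fun i => Arena.follow hπ i) 1 σ') ∈ A.multiEnergy cost)
    (m : ℕ) : A.outcome (Function.update (fun i => Arena.follow hπ i) 1 σ') m ≠ G.trap := by
  intro hm
  obtain ⟨hπ', hσ⟩ := A.outcome_spec (Function.update (fun i => Arena.follow hπ i) 1 σ')
  set π' := A.outcome (Function.update (fun i => Arena.follow hπ i) 1 σ')
  have hne : ∃ n, π' n ≠ π n := ⟨m, fun h => G.ne_trap_of_halt hπ hT m (h.symm.trans hm)⟩
  classical
  -- The two plays part after step `k`, which has to be a move of player `1`.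
  obtain ⟨k, hk⟩ : ∃ k, Nat.find hne = k + 1 := by
    refine Nat.exists_eq_succ_of_ne_zero fun h0 => ?_
    have := Nat.find_spec hne
    rw [h0] at this
    exact this (hπ'.1.trans hπ.1.symm)
  have hagree : ∀ j ≤ k, π' j = π j := fun j hj => by
    by_contra h
    have := Nat.find_min' hne h
    omega
  have hpart : π' (k + 1) ≠ π (k + 1) := hk ▸ Nat.find_spec hne
  have hpre : playPrefix π' k = playPrefix π k := playPrefix_congr hagree
  have hown : A.owner (π k) = 1 := by
    by_contra h
    have hmem := Arena.playPrefix_mem_histOf hπ k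
    have h1 := (hσ (A.owner (π k))).2 k (hpre ▸ hmem)
    rw [Function.update_of_ne h] at h1
    refine hpart (h1.symm.trans ?_)
    rw [← Arena.follow_move hπ _ k hmem]
    exact congrArg (Arena.follow hπ _).move (Subtype.ext hpre)
  have hnt : ∀ j, π j ≠ G.trap := G.ne_trap_of_halt hπ hT
  obtain ⟨r, hr⟩ := G.test_of_owner _ (hnt k) hown
  have hnext : π' (k + 1) = G.trap := by
    by_contra h
    exact hpart (G.eq_of_test _ r _ _ hr (hagree k le_rfl ▸ hπ'.2 k) (hπ.2 k) h (hnt _))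
  have hkT : k < T := by
    by_contra h
    exact G.test_halt r (G.halt_forever hπ hT (not_lt.1 h) ▸ hr)
  have h0 : 0 ≤ level cost π' (k + 1) r := hen.2 (k + 1) r
  rw [level_succ, level_congr hagree, hz k hkT r hr, hagree k le_rfl, hnext,
    G.cost_of_test _ r hr] at h0
  simp at h0

/-- If player `0` wants to reach `halt`, player `1` wants to reach `trap` and the global objective
is to reach `halt`, then there is a solution if and only if `halt` can be reached by regular moves. -/
theorem exists_isSolution_iff {obj : Fin 2 → Set (ℕ → S)} {spec : Set (ℕ → S)}
    (h0 : obj 0 = {π | π ∈ A.plays ∧ ∃ k, π k = G.halt})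
    (h1 : obj 1 = {π | π ∈ A.plays ∧ ∃ k, π k = G.trap})
    (hspec : spec = {π | π ∈ A.plays ∧ ∃ k, π k = G.halt}) :
    (∃ σ : A.Profile, A.IsSolution cost obj spec σ) ↔
      ∃ c, Relation.ReflTransGen G.Move (A.init, 0) (G.halt, c) := by
  constructor
  · rintro ⟨σ, ⟨hen, hsp⟩, hdev⟩
    rw [hspec] at hsp
    obtain ⟨hπ, T, hT⟩ := hsp
    have key : ∀ k ≤ T, Relation.ReflTransGen G.Move (A.init, 0)
        (A.outcome σ k, fun r => (level cost (A.outcome σ) k r).toNat) := by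
      intro k hk
      induction k with
      | zero =>
        rw [hπ.1]
        exact Relation.ReflTransGen.refl
      | succ k ih =>
        refine (ih (by omega)).tail
          ⟨hπ.2 k, G.ne_trap_of_halt hπ hT _, fun r hr => ?_, fun r => ?_⟩
        · by_contra hne
          obtain ⟨σ', hen', m, hm⟩ := G.exists_deviation σ hen hr (fun h => hne (by simp [h]))
          have := hdev 1 σ' (by rw [h1]; exact ⟨⟨hen'.1, m, hm⟩, hen'⟩)
          rw [h1] at this
          obtain ⟨-, m', hm'⟩ := this
          exact G.ne_trap_of_halt hπ hT m' hm'
        · have e1 : 0 ≤ level cost (A.outcome σ) k r := hen.2 k r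
          have e2 : 0 ≤ level cost (A.outcome σ) (k + 1) r := hen.2 (k + 1) r
          change ((level cost (A.outcome σ) (k + 1) r).toNat : ℤ) =
            (level cost (A.outcome σ) k r).toNat + _
          rw [Int.toNat_of_nonneg e1, Int.toNat_of_nonneg e2, level_succ]
    exact ⟨_, hT ▸ key T le_rfl⟩
  · rintro ⟨c, hc⟩
    obtain ⟨π, hπ, T, hT, -, hnn, hz⟩ := G.exists_play hc
    have hhalt : ∀ j, level cost π (T + j) = level cost π T := by
      intro j
      induction j with
      | zero => rfl
      | succ j ih =>
        funext r
        rw [← Nat.add_assoc, level_succ, ih, G.halt_forever hπ hT (m := T + j) (by omega),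
          G.halt_forever hπ hT (m := T + j + 1) (by omega), G.halt_cost]
        simp
    refine ⟨fun i => Arena.follow hπ i, ?_⟩
    rw [Arena.IsSolution, Arena.follow_outcome hπ]
    refine ⟨⟨⟨hπ, fun k r => ?_⟩, hspec ▸ ⟨hπ, T, hT⟩⟩, fun i σ' h => ?_⟩
    · change 0 ≤ level cost π k r
      rcases le_total k T with h | h
      · exact hnn k h r
      · obtain ⟨j, rfl⟩ := Nat.exists_eq_add_of_le h
        rw [hhalt]
        exact hnn T le_rfl r
    · rcases eq_or_ne i 1 with rfl | hi
      · rw [h1] at h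
        obtain ⟨m, hm⟩ := h.1.2
        exact absurd hm (G.not_exists_deviation hπ hT hz σ' h.2 m)
      · obtain rfl : i = 0 := by omega
        exact h0 ▸ ⟨hπ, T, hT⟩

end CounterGame

end CarefulSynthesis

namespace CarefulSynthesis

open Relation

/-! ### Regular programs and automata with counters -/

/-- The relations that are generated from those in `B` by composition, iteration and finite
unions: the input-output relations of the regular, possibly nondeterministic,
programs with basic instructions `B`. -/
inductive Regular {α : Type} (B : Set (α → α → Prop)) : (α → α → Prop) → Prop
  | base {R} : R ∈ B → Regular B R
  | comp {R S} : Regular B R → Regular B S → Regular B (Comp R S)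
  | star {R} : Regular B R → Regular B (ReflTransGen R)
  | iUnion {n} {R : Fin n → α → α → Prop} : (∀ i, Regular B (R i)) →
      Regular B (fun a b => ∃ i, R i a b)

/-- Through the encoding `e`, the relation `R'` does exactly what `R` does. -/
def Simulates {α β : Type} (e : α → β) (R' : β → β → Prop) (R : α → α → Prop) : Prop :=
  ∀ a b, R' (e a) b ↔ ∃ a', e a' = b ∧ R a a'

/-- A simulation of the basic instructions extends to all regular programs. -/
theorem Regular.exists_simulates {α β : Type} {e : α → β} {B : Set (α → α → Prop)}
    {B' : Set (β → β → Prop)} (h : ∀ R ∈ B, ∃ R', Regular B' R' ∧ Simulates e R' R)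
    {R : α → α → Prop} (hR : Regular B R) : ∃ R', Regular B' R' ∧ Simulates e R' R := by
  induction hR with
  | base hR => exact h _ hR
  | @comp R S _ _ ihR ihS =>
    obtain ⟨R', hR', sR⟩ := ihR
    obtain ⟨S', hS', sS⟩ := ihS
    refine ⟨_, hR'.comp hS', fun a b => ⟨?_, ?_⟩⟩
    · rintro ⟨c, h1, h2⟩
      obtain ⟨c, rfl, h3⟩ := (sR _ _).1 h1
      obtain ⟨d, rfl, h4⟩ := (sS _ _).1 h2
      exact ⟨d, rfl, c, h3, h4⟩
    · rintro ⟨d, rfl, c, h1, h2⟩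
      exact ⟨e c, (sR _ _).2 ⟨c, rfl, h1⟩, (sS _ _).2 ⟨d, rfl, h2⟩⟩
  | @star R _ ih =>
    obtain ⟨R', hR', sR⟩ := ih
    refine ⟨_, hR'.star, fun a b => ⟨fun h => ?_, ?_⟩⟩
    · induction h with
      | refl => exact ⟨a, rfl, .refl⟩
      | tail _ h2 ih =>
        obtain ⟨c, rfl, h1⟩ := ih
        obtain ⟨d, rfl, h3⟩ := (sR _ _).1 h2
        exact ⟨d, rfl, h1.tail h3⟩
    · rintro ⟨d, rfl, h⟩
      exact h.lift e fun x y hxy => (sR _ _).2 ⟨y, rfl, hxy⟩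
  | @iUnion n R _ ih =>
    choose R' hR' sR using ih
    refine ⟨_, .iUnion hR', fun a b => ⟨?_, ?_⟩⟩
    · rintro ⟨i, h⟩
      obtain ⟨c, rfl, h'⟩ := (sR i _ _).1 h
      exact ⟨c, rfl, i, h'⟩
    · rintro ⟨c, rfl, i, h⟩
      exact ⟨i, (sR i _ _).2 ⟨c, rfl, h⟩⟩

/-- An instruction for two counters: it optionally tests one counter for zero, and then adds a
vector of integers to the counters. -/
structure Act where
  test : Option (Fin 2)
  add : Fin 2 → ℤ

/-- The effect of an instruction. It is blocked if the test fails or if some counter would become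
negative. -/
def Act.rel (a : Act) (c c' : Fin 2 → ℕ) : Prop :=
  (∀ r, a.test = some r → c r = 0) ∧ ∀ r, (c' r : ℤ) = c r + a.add r

/-- The instruction that does nothing. -/
def Act.skip : Act := ⟨none, 0⟩

theorem Act.rel_skip {c c' : Fin 2 → ℕ} : Act.skip.rel c c' ↔ c' = c := by
  simp [Act.rel, Act.skip, funext_iff]

/-- A finite nondeterministic automaton with two counters. A state carries the instruction that is
executed when the state is left. States with a zero test have at most one successor, and the final
state carries no instruction. -/
structure Automaton where
  Q : Type
  fintype : Fintype Q
  act : Q → Act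
  edge : Q → Q → Prop
  start : Q
  final : Q
  eq_of_test : ∀ q r, (act q).test = some r → ∀ t t', edge q t → edge q t' → t = t'
  act_final : act final = Act.skip

namespace Automaton

/-- The steps between configurations, which consist of a state and counter values. -/
def Step (A : Automaton) (x y : A.Q × (Fin 2 → ℕ)) : Prop :=
  A.edge x.1 y.1 ∧ (A.act x.1).rel x.2 y.2

/-- The automaton leads from counter values `c` in its start state to `c'` in its final state. -/
def Reaches (A : Automaton) (c c' : Fin 2 → ℕ) : Prop :=
  ReflTransGen A.Step (A.start, c) (A.final, c')

theorem test_final (A : Automaton) (r : Fin 2) : (A.act A.final).test ≠ some r := by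
  simp [A.act_final, Act.skip]

/-- The automaton that executes a single instruction. -/
def single (a : Act) : Automaton where
  Q := Bool
  fintype := inferInstance
  act q := if q then a else Act.skip
  edge q q' := q = true ∧ q' = false
  start := true
  final := false
  eq_of_test _ _ _ _ _ h h' := h.2.trans h'.2.symm
  act_final := rfl

theorem reaches_single (a : Act) {c c' : Fin 2 → ℕ} : (single a).Reaches c c' ↔ a.rel c c' := by
  constructor
  · intro h
    suffices H : ∀ y, ReflTransGen (single a).Step (true, c) y →
        y = (true, c) ∨ y.1 = false ∧ a.rel c y.2 by
      rcases H _ h with h | h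
      · exact absurd (congrArg Prod.fst h) Bool.false_ne_true
      · exact h.2
    intro y h
    induction h with
    | refl => exact Or.inl rfl
    | tail _ h2 ih =>
      rcases ih with rfl | ih
      · exact Or.inr ⟨h2.1.2, h2.2⟩
      · exact absurd (ih.1.symm.trans h2.1.1) Bool.false_ne_true
  · exact fun h => .single ⟨⟨rfl, rfl⟩, h⟩

/-- Run one automaton after the other. -/
def seq (A B : Automaton) : Automaton where
  Q := A.Q ⊕ B.Q
  fintype := letI := A.fintype; letI := B.fintype; inferInstance
  act := Sum.elim A.act B.act
  edge
    | .inl q, .inl q' => A.edge q q'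
    | .inl q, .inr q' => q = A.final ∧ q' = B.start
    | .inr _, .inl _ => False
    | .inr q, .inr q' => B.edge q q'
  start := .inl A.start
  final := .inr B.final
  eq_of_test := by
    rintro (q | q) r hr (t | t) (t' | t') h h'
    · exact congrArg _ (A.eq_of_test q r hr t t' h h')
    · exact absurd (h'.1 ▸ hr) (A.test_final r)
    · exact absurd (h.1 ▸ hr) (A.test_final r)
    · exact absurd (h.1 ▸ hr) (A.test_final r)
    · exact h.elim
    · exact h.elim
    · exact h'.elim
    · exact congrArg _ (B.eq_of_test q r hr t t' h h')
  act_final := B.act_final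

theorem reaches_seq (A B : Automaton) {c c' : Fin 2 → ℕ} :
    (A.seq B).Reaches c c' ↔ ∃ d, A.Reaches c d ∧ B.Reaches d c' := by
  constructor
  · intro h
    suffices H : ∀ y, ReflTransGen (A.seq B).Step (.inl A.start, c) y →
        (∃ q, y.1 = .inl q ∧ ReflTransGen A.Step (A.start, c) (q, y.2)) ∨
        ∃ q, y.1 = .inr q ∧ ∃ d, A.Reaches c d ∧ ReflTransGen B.Step (B.start, d) (q, y.2) by
      obtain ⟨q, hq, -⟩ | ⟨q, hq, h⟩ := H _ h
      · exact absurd hq.symm Sum.inl_ne_inr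
      · obtain rfl : B.final = q := Sum.inr.inj hq
        exact h
    intro y h
    induction h with
    | refl => exact .inl ⟨_, rfl, .refl⟩
    | @tail x y _ h2 ih =>
      obtain ⟨x, d⟩ := x
      obtain ⟨y, d'⟩ := y
      obtain ⟨q, rfl, h⟩ | ⟨q, rfl, e, h, h'⟩ := ih <;> rcases y with q' | q'
      · exact .inl ⟨q', rfl, h.tail h2⟩
      · obtain ⟨⟨rfl, rfl⟩, h2⟩ := h2
        simp only [seq, Sum.elim_inl, A.act_final, Act.rel_skip] at h2
        subst h2
        exact .inr ⟨_, rfl, _, h, .refl⟩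
      · exact h2.1.elim
      · exact .inr ⟨q', rfl, e, h, h'.tail h2⟩
  · rintro ⟨d, h1, h2⟩
    have e1 : ReflTransGen (A.seq B).Step (Sum.inl A.start, c) (Sum.inl A.final, d) :=
      ReflTransGen.lift (r := A.Step) (p := (A.seq B).Step)
        (fun x => (Sum.inl x.1, x.2)) (fun _ _ h => h) _ _ h1
    have e2 : (A.seq B).Step (Sum.inl A.final, d) (Sum.inr B.start, d) :=
      ⟨⟨rfl, rfl⟩, by simp [seq, A.act_final, Act.rel_skip]⟩
    have e3 : ReflTransGen (A.seq B).Step (Sum.inr B.start, d) (Sum.inr B.final, c') :=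
      ReflTransGen.lift (r := B.Step) (p := (A.seq B).Step)
        (fun x => (Sum.inr x.1, x.2)) (fun _ _ h => h) _ _ h2
    exact e1.trans (e3.head e2)

/-- Run an automaton any number of times. -/
def star (A : Automaton) : Automaton where
  Q := Option A.Q
  fintype := letI := A.fintype; inferInstance
  act q := q.elim Act.skip A.act
  edge
    | none, none => False
    | none, some q => q = A.start
    | some q, none => q = A.final
    | some q, some q' => A.edge q q'
  start := none
  final := none
  eq_of_test := by
    rintro (_ | q) r hr (_ | t) (_ | t') h h'
    · rfl
    · exact h.elim
    · exact h'.elim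
    · exact congrArg _ (h.trans h'.symm)
    · rfl
    · exact absurd (h ▸ hr) (A.test_final r)
    · exact absurd (h' ▸ hr) (A.test_final r)
    · exact congrArg _ (A.eq_of_test q r hr t t' h h')
  act_final := rfl

theorem reaches_star (A : Automaton) {c c' : Fin 2 → ℕ} :
    A.star.Reaches c c' ↔ ReflTransGen A.Reaches c c' := by
  constructor
  · intro h
    suffices H : ∀ y, ReflTransGen A.star.Step (none, c) y →
        (y.1 = none ∧ ReflTransGen A.Reaches c y.2) ∨
        ∃ q, y.1 = some q ∧ ∃ d, ReflTransGen A.Reaches c d ∧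
          ReflTransGen A.Step (A.start, d) (q, y.2) by
      obtain ⟨-, h⟩ | ⟨q, hq, -⟩ := H _ h
      · exact h
      · exact absurd hq.symm (Option.some_ne_none q)
    intro y h
    induction h with
    | refl => exact .inl ⟨rfl, .refl⟩
    | @tail x y _ h2 ih =>
      obtain ⟨x, d⟩ := x
      obtain ⟨y, d'⟩ := y
      obtain ⟨rfl, h⟩ | ⟨q, rfl, e, h, h'⟩ := ih <;> rcases y with _ | q'
      · exact h2.1.elim
      · obtain ⟨rfl, h2⟩ := h2
        obtain rfl := Act.rel_skip.1 h2
        exact .inr ⟨_, rfl, _, h, .refl⟩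
      · obtain ⟨rfl, h2⟩ := h2
        simp only [star, Option.elim_some, A.act_final, Act.rel_skip] at h2
        subst h2
        exact .inl ⟨rfl, h.tail h'⟩
      · exact .inr ⟨q', rfl, e, h, h'.tail h2⟩
  · intro h
    induction h with
    | refl => exact .refl
    | @tail d d' _ h2 ih =>
      refine ih.trans (.head (b := (some A.start, d)) ⟨rfl, Act.rel_skip.2 rfl⟩
        (.tail (b := (some A.final, d')) (h2.lift (fun x => (some x.1, x.2)) ?_) ⟨rfl, ?_⟩))
      · exact fun _ _ h => h
      · simp [star, A.act_final, Act.rel_skip]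

/-- The edges of a union of automata, with a new start state `none` and a new final state
`some none`. -/
inductive UnionEdge {n : ℕ} (A : Fin n → Automaton) :
    Option (Option (Σ i, (A i).Q)) → Option (Option (Σ i, (A i).Q)) → Prop
  | enter (i) : UnionEdge A none (some (some ⟨i, (A i).start⟩))
  | exit (i) : UnionEdge A (some (some ⟨i, (A i).final⟩)) (some none)
  | inner (i) {q q'} : (A i).edge q q' → UnionEdge A (some (some ⟨i, q⟩)) (some (some ⟨i, q'⟩))

/-- Run one automaton out of a finite family. -/
def union {n : ℕ} (A : Fin n → Automaton) : Automaton where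
  Q := Option (Option (Σ i, (A i).Q))
  fintype := letI := fun i => (A i).fintype; inferInstance
  act
    | none => Act.skip
    | some none => Act.skip
    | some (some q) => (A q.1).act q.2
  edge := UnionEdge A
  start := none
  final := some none
  eq_of_test := by
    rintro (_ | _ | ⟨i, q⟩) r hr t t' h h'
    · simp [Act.skip] at hr
    · simp [Act.skip] at hr
    · cases h with
      | exit => exact absurd hr ((A i).test_final r)
      | inner _ h =>
        cases h' with
        | exit => exact absurd hr ((A i).test_final r)
        | inner _ h' => rw [(A i).eq_of_test q r hr _ _ h h']
  act_final := rfl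

theorem reaches_union {n : ℕ} (A : Fin n → Automaton) {c c' : Fin 2 → ℕ} :
    (union A).Reaches c c' ↔ ∃ i, (A i).Reaches c c' := by
  constructor
  · intro h
    suffices H : ∀ y, ReflTransGen (union A).Step (none, c) y →
        y = (none, c) ∨ (y.1 = some none ∧ ∃ i, (A i).Reaches c y.2) ∨
        ∃ i q, y.1 = some (some ⟨i, q⟩) ∧
          ReflTransGen (A i).Step ((A i).start, c) (q, y.2) by
      obtain h | ⟨-, h⟩ | ⟨i, q, hq, -⟩ := H _ h
      · exact absurd (congrArg Prod.fst h) (Option.some_ne_none _)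
      · exact h
      · exact absurd (Option.some.inj hq).symm (Option.some_ne_none _)
    intro y h
    induction h with
    | refl => exact .inl rfl
    | @tail x y _ h2 ih =>
      obtain ⟨x, d⟩ := x
      obtain ⟨y, d'⟩ := y
      obtain ⟨h2, h3⟩ := h2
      dsimp only at h2 h3 ih ⊢
      right
      cases h2 with
      | enter i =>
        obtain rfl := Act.rel_skip.1 h3
        rcases ih with h | ⟨h, -⟩ | ⟨_, _, h, -⟩
        · cases h
          exact .inr ⟨i, _, rfl, .refl⟩
        · cases h
        · cases h
      | exit i =>
        rcases ih with h | ⟨h, -⟩ | ⟨_, _, h, h'⟩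
        · cases h
        · cases h
        · cases h
          simp only [union, (A i).act_final, Act.rel_skip] at h3
          subst h3
          exact .inl ⟨rfl, i, h'⟩
      | inner i h2 =>
        rcases ih with h | ⟨h, -⟩ | ⟨_, _, h, h'⟩
        · cases h
        · cases h
        · cases h
          exact .inr ⟨i, _, rfl, h'.tail ⟨h2, h3⟩⟩
  · rintro ⟨i, h⟩
    have e1 : (union A).Step (none, c) (some (some ⟨i, (A i).start⟩), c) :=
      ⟨UnionEdge.enter (A := A) i, Act.rel_skip.2 rfl⟩
    have e2 : ReflTransGen (union A).Step (some (some ⟨i, (A i).start⟩), c)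
        (some (some ⟨i, (A i).final⟩), c') :=
      ReflTransGen.lift (r := (A i).Step) (p := (union A).Step)
        (fun x => (some (some ⟨i, x.1⟩), x.2))
        (fun _ _ h => ⟨UnionEdge.inner (A := A) i h.1, h.2⟩) _ _ h
    have e3 : (union A).Step (some (some ⟨i, (A i).final⟩), c') (some none, c') :=
      ⟨UnionEdge.exit (A := A) i, by simp [union, (A i).act_final, Act.rel_skip]⟩
    exact (e2.tail e3).head e1

end Automaton

/-- Regular programs with two counters can be executed by automata. -/
theorem Regular.exists_automaton {R : (Fin 2 → ℕ) → (Fin 2 → ℕ) → Prop}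
    (h : Regular (Set.range Act.rel) R) : ∃ A : Automaton, A.Reaches = R := by
  induction h with
  | base h =>
    obtain ⟨a, rfl⟩ := h
    exact ⟨.single a, funext₂ fun c c' => propext (Automaton.reaches_single a)⟩
  | comp _ _ ih1 ih2 =>
    obtain ⟨A, rfl⟩ := ih1
    obtain ⟨B, rfl⟩ := ih2
    exact ⟨A.seq B, funext₂ fun c c' => propext (A.reaches_seq B)⟩
  | star _ ih =>
    obtain ⟨A, rfl⟩ := ih
    exact ⟨A.star, funext₂ fun c c' => propext A.reaches_star⟩
  | iUnion _ ih =>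
    choose A hA using ih
    refine ⟨.union A, funext₂ fun c c' => propext ?_⟩
    simp only [Automaton.reaches_union, hA]

end CarefulSynthesis

namespace CarefulSynthesis

open Relation

/-! ### Register programs on two counters -/

/-- A loop that adds `v` adds some multiple of `v`, and is blocked only by the final values. -/
theorem reflTransGen_add_iff {v : Fin 2 → ℤ} {c c' : Fin 2 → ℕ} :
    ReflTransGen (Act.rel ⟨none, v⟩) c c' ↔ ∃ k : ℕ, ∀ r, (c' r : ℤ) = c r + k * v r := by
  constructor
  · intro h
    induction h with
    | refl => exact ⟨0, by simp⟩
    | tail _ h2 ih =>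
      obtain ⟨k, hk⟩ := ih
      refine ⟨k + 1, fun r => ?_⟩
      rw [h2.2 r, hk r]
      push_cast
      ring
  · rintro ⟨k, hk⟩
    induction k generalizing c' with
    | zero =>
      have : c' = c := funext fun r => by simpa using hk r
      rw [this]
    | succ k ih =>
      -- The counters lie between the values of `c` and `c'` before the last step.
      have hnn : ∀ r, 0 ≤ (c r : ℤ) + k * v r := fun r => by
        have := hk r
        push_cast at this
        rcases le_total 0 (v r) with h | h
        · positivity
        · nlinarith
      refine (ih (c' := fun r => ((c r : ℤ) + k * v r).toNat)
        fun r => Int.toNat_of_nonneg (hnn r)).tail ⟨by simp, fun r => ?_⟩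
      rw [hk r, Int.toNat_of_nonneg (hnn r)]
      push_cast
      ring

/-- The counter program that replaces `k * m` by `k * m'` in the first counter. -/
def scale (m m' : ℕ) : (Fin 2 → ℕ) → (Fin 2 → ℕ) → Prop :=
  Comp (ReflTransGen (Act.rel ⟨none, ![-m, m']⟩)) <| Comp (Act.rel ⟨some 0, 0⟩) <|
    Comp (ReflTransGen (Act.rel ⟨none, ![1, -1]⟩)) (Act.rel ⟨some 1, 0⟩)

theorem regular_scale (m m' : ℕ) : Regular (Set.range Act.rel) (scale m m') :=
  .comp (.star (.base ⟨_, rfl⟩)) (.comp (.base ⟨_, rfl⟩)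
    (.comp (.star (.base ⟨_, rfl⟩)) (.base ⟨_, rfl⟩)))

theorem scale_iff {m m' x : ℕ} {c : Fin 2 → ℕ} :
    scale m m' ![x, 0] c ↔ ∃ k, x = k * m ∧ c = ![k * m', 0] := by
  constructor
  · rintro ⟨c1, h1, c2, h2, c3, h3, h4⟩
    obtain ⟨k, hk⟩ := reflTransGen_add_iff.1 h1
    obtain ⟨j, hj⟩ := reflTransGen_add_iff.1 h3
    obtain ⟨t2, h2⟩ := h2
    obtain ⟨t4, h4⟩ := h4
    have t2 := t2 0 rfl
    have t4 := t4 1 rfl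
    simp only [Fin.forall_fin_two, Pi.zero_apply, Matrix.cons_val_zero, Matrix.cons_val_one,
      add_zero, Nat.cast_zero, zero_add, mul_one, mul_neg] at hk hj h2 h4
    refine ⟨k, ?_, funext <| Fin.forall_fin_two.2 ⟨?_, ?_⟩⟩
    · zify
      omega
    · rw [Matrix.cons_val_zero]
      zify
      omega
    · rw [Matrix.cons_val_one]
      simp only [Matrix.cons_val_zero]
      omega
  · rintro ⟨k, rfl, rfl⟩
    refine ⟨![0, k * m'], reflTransGen_add_iff.2 ⟨k, ?_⟩, ![0, k * m'], ⟨?_, ?_⟩, ![k * m', 0],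
      reflTransGen_add_iff.2 ⟨k * m', ?_⟩, ?_, ?_⟩ <;> simp [Fin.forall_fin_two]

/-- The counter program that checks that the first counter is not divisible by `p`, by guessing its
remainder. -/
def testNotDvd (p : ℕ) : (Fin 2 → ℕ) → (Fin 2 → ℕ) → Prop := fun c c' => ∃ i : Fin (p - 1),
  (Comp (ReflTransGen (Act.rel ⟨none, ![-p, 1]⟩)) <| Comp (Act.rel ⟨none, ![-(i + 1 : ℕ), 0]⟩) <|
    Comp (Act.rel ⟨some 0, ![(i + 1 : ℕ), 0]⟩) <|
      Comp (ReflTransGen (Act.rel ⟨none, ![p, -1]⟩)) (Act.rel ⟨some 1, 0⟩)) c c'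

theorem regular_testNotDvd (p : ℕ) : Regular (Set.range Act.rel) (testNotDvd p) :=
  .iUnion fun _ => .comp (.star (.base ⟨_, rfl⟩)) (.comp (.base ⟨_, rfl⟩)
    (.comp (.base ⟨_, rfl⟩) (.comp (.star (.base ⟨_, rfl⟩)) (.base ⟨_, rfl⟩))))

theorem testNotDvd_iff {p x : ℕ} (hp : 0 < p) {c : Fin 2 → ℕ} :
    testNotDvd p ![x, 0] c ↔ ¬ p ∣ x ∧ c = ![x, 0] := by
  constructor
  · rintro ⟨⟨i, hi⟩, c1, h1, c2, h2, c3, h3, c4, h4, h5⟩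
    obtain ⟨k, hk⟩ := reflTransGen_add_iff.1 h1
    obtain ⟨j, hj⟩ := reflTransGen_add_iff.1 h4
    obtain ⟨-, h2⟩ := h2
    obtain ⟨t3, h3⟩ := h3
    obtain ⟨t5, h5⟩ := h5
    have t3 := t3 0 rfl
    have t5 := t5 1 rfl
    simp only [Fin.forall_fin_two, Pi.zero_apply, Matrix.cons_val_zero, Matrix.cons_val_one,
      add_zero, Nat.cast_zero, zero_add, mul_one, mul_neg] at hk hj h2 h3 h5
    have hkj : k = j := by omega
    subst hkj
    have hx : x = k * p + (i + 1) := by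
      zify
      push_cast at h2
      omega
    refine ⟨fun hd => ?_, funext <| Fin.forall_fin_two.2 ⟨?_, ?_⟩⟩
    · have h' : p ∣ i + 1 := (Nat.dvd_add_right (Dvd.intro_left k rfl)).1 (hx ▸ hd)
      have := Nat.le_of_dvd (Nat.succ_pos i) h'
      omega
    · rw [Matrix.cons_val_zero]
      omega
    · rw [Matrix.cons_val_one]
      simp only [Matrix.cons_val_zero]
      omega
  · rintro ⟨hd, rfl⟩
    have hr : x % p ≠ 0 := fun h => hd (Nat.dvd_of_mod_eq_zero h)
    have hlt := Nat.mod_lt x hp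
    have hx := Nat.div_add_mod x p
    have hx' : (x : ℤ) = p * (x / p : ℕ) + (x % p : ℕ) := by exact_mod_cast hx.symm
    have hi : x % p - 1 + 1 = x % p := by omega
    refine ⟨⟨x % p - 1, by omega⟩, ![x % p, x / p], reflTransGen_add_iff.2 ⟨x / p, ?_⟩,
      ![0, x / p], ⟨?_, ?_⟩, ![x % p, x / p], ⟨?_, ?_⟩, ![x, 0],
      reflTransGen_add_iff.2 ⟨x / p, ?_⟩, ?_, ?_⟩ <;>
      simp only [hi, Fin.forall_fin_two, Matrix.cons_val_zero, Matrix.cons_val_one,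
        Pi.zero_apply, add_zero, Nat.cast_zero, zero_add, mul_one, mul_neg, reduceCtorEq,
        false_imp_iff, and_self, true_and, and_true, forall_const, add_neg_cancel,
        Option.some.injEq, Fin.isValue]
    · rw [hx']
      push_cast
      ring
    · simp
    · rw [hx']
      push_cast
      ring
    · simp

/-- The register instruction that subtracts `d` and then adds `e`. It is blocked if some register
is smaller than `d` requires. -/
def exchange (d e σ τ : ℕ →₀ ℕ) : Prop := ∃ ρ, σ = ρ + d ∧ τ = ρ + e

/-- The register instruction that tests register `r` for zero. -/
def zeroTest (r : ℕ) (σ τ : ℕ →₀ ℕ) : Prop := τ = σ ∧ σ r = 0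

/-- The instructions of programs with registers `0, 1, 2, …`. -/
inductive RegisterInstr : ((ℕ →₀ ℕ) → (ℕ →₀ ℕ) → Prop) → Prop
  | exchange (d e) : RegisterInstr (exchange d e)
  | zeroTest (r) : RegisterInstr (zeroTest r)

/-- Relations between register contents that are computed by regular register programs. -/
abbrev RegisterProgram : ((ℕ →₀ ℕ) → (ℕ →₀ ℕ) → Prop) → Prop := Regular {R | RegisterInstr R}

/-- The encoding of register contents by a number in which the exponent of the `i`-th prime is the
content of register `i`. -/
noncomputable def registerCode (σ : ℕ →₀ ℕ) : ℕ := σ.prod fun i x => Nat.nth Nat.Prime i ^ x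

theorem prime_nth (i : ℕ) : (Nat.nth Nat.Prime i).Prime :=
  Nat.nth_mem_of_infinite Nat.infinite_setOfPred_prime i

theorem registerCode_add (σ τ : ℕ →₀ ℕ) :
    registerCode (σ + τ) = registerCode σ * registerCode τ :=
  Finsupp.prod_add_index' (fun _ => pow_zero _) fun _ _ _ => pow_add _ _ _

theorem registerCode_single (i x : ℕ) :
    registerCode (Finsupp.single i x) = Nat.nth Nat.Prime i ^ x :=
  Finsupp.prod_single_index (pow_zero _)

theorem registerCode_pos (σ : ℕ →₀ ℕ) : 0 < registerCode σ :=
  Finset.prod_pos fun i _ => pow_pos (prime_nth i).pos _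

theorem nth_prime_pow_dvd_registerCode_iff (σ : ℕ →₀ ℕ) (i k : ℕ) :
    Nat.nth Nat.Prime i ^ k ∣ registerCode σ ↔ k ≤ σ i := by
  have hsplit : registerCode σ = Nat.nth Nat.Prime i ^ σ i * registerCode (σ.erase i) := by
    rw [← registerCode_single, ← registerCode_add, Finsupp.single_add_erase]
  have hcop : (Nat.nth Nat.Prime i).Coprime (registerCode (σ.erase i)) := by
    refine Nat.Coprime.prod_right fun j hj => Nat.Coprime.pow_right _ ?_
    refine (Nat.coprime_primes (prime_nth i) (prime_nth j)).2 fun h => ?_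
    have := Nat.nth_injective Nat.infinite_setOfPred_prime h
    rw [Finsupp.support_erase, Finset.mem_erase] at hj
    exact hj.1 this.symm
  rw [hsplit, (hcop.pow_left k).dvd_mul_right, Nat.pow_dvd_pow_iff_le_right (prime_nth i).one_lt]

theorem registerCode_dvd_iff (d σ : ℕ →₀ ℕ) : registerCode d ∣ registerCode σ ↔ d ≤ σ := by
  constructor
  · intro h i
    exact (nth_prime_pow_dvd_registerCode_iff σ i _).1
      (((nth_prime_pow_dvd_registerCode_iff d i _).2 le_rfl).trans h)
  · intro h
    rw [← tsub_add_cancel_of_le h, registerCode_add]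
    exact Dvd.intro_left _ rfl

/-- Two counters can do the work of any number of registers. -/
theorem RegisterProgram.exists_simulates {R : (ℕ →₀ ℕ) → (ℕ →₀ ℕ) → Prop}
    (h : RegisterProgram R) : ∃ R', Regular (Set.range Act.rel) R' ∧
      Simulates (fun σ => ![registerCode σ, 0]) R' R := by
  refine Regular.exists_simulates (fun R hR => ?_) h
  cases hR with
  | exchange d e =>
    refine ⟨_, regular_scale (registerCode d) (registerCode e), fun σ c => ?_⟩
    rw [scale_iff]
    constructor
    · rintro ⟨k, hk, rfl⟩
      have hd := (registerCode_dvd_iff d σ).1 ⟨k, by rw [hk, mul_comm]⟩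
      have hk' : registerCode (σ - d) = k := by
        apply Nat.eq_of_mul_eq_mul_right (registerCode_pos d)
        rw [← registerCode_add, tsub_add_cancel_of_le hd, hk]
      exact ⟨σ - d + e, by simp only [registerCode_add, hk'], σ - d,
        (tsub_add_cancel_of_le hd).symm, rfl⟩
    · rintro ⟨τ, rfl, ρ, rfl, rfl⟩
      exact ⟨registerCode ρ, registerCode_add _ _, by simp only [registerCode_add]⟩
  | zeroTest r =>
    refine ⟨_, regular_testNotDvd (Nat.nth Nat.Prime r), fun σ c => ?_⟩
    rw [testNotDvd_iff (prime_nth r).pos]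
    have := nth_prime_pow_dvd_registerCode_iff σ r 1
    rw [pow_one] at this
    rw [this]
    constructor
    · rintro ⟨h, rfl⟩
      exact ⟨σ, rfl, rfl, by omega⟩
    · rintro ⟨τ, rfl, rfl, h⟩
      exact ⟨by omega, rfl⟩

end CarefulSynthesis

namespace CarefulSynthesis

open Relation Finsupp

/-! ### Register programs for recursive functions -/

/-- Started in `a`, the program `R` can only end in `b`, and can do so. -/
def Runs {α : Type} (R : α → α → Prop) (a b : α) : Prop := ∀ c, R a c ↔ c = b

theorem Runs.comp {α : Type} {R S : α → α → Prop} {a b c : α} (h : Runs R a b) (h' : Runs S b c) :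
    Runs (Comp R S) a c := fun d => by
  simp only [Comp, h _, exists_eq_left, h' _]

theorem Runs.of_eq {α : Type} {R : α → α → Prop} {a a' b b' : α} (h : Runs R a b) (ha : a = a')
    (hb : b = b') : Runs R a' b' := ha ▸ hb ▸ h

/-- A loop whose body leads from `T k` to `T (k + 1)` only, provided that `P k` holds. -/
theorem reflTransGen_iff_of_forall {α : Type} {B : α → α → Prop} {T : ℕ → α} {P : ℕ → Prop}
    (h : ∀ k c, B (T k) c ↔ P k ∧ c = T (k + 1)) (c : α) :
    ReflTransGen B (T 0) c ↔ ∃ k, (∀ i < k, P i) ∧ c = T k := by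
  constructor
  · intro hc
    induction hc with
    | refl => exact ⟨0, by simp, rfl⟩
    | tail _ h2 ih =>
      obtain ⟨k, hk, rfl⟩ := ih
      obtain ⟨h3, h4⟩ := (h _ _).1 h2
      refine ⟨k + 1, fun i hi => ?_, h4⟩
      rcases Nat.lt_succ_iff_lt_or_eq.1 hi with hi | rfl
      · exact hk i hi
      · exact h3
  · rintro ⟨k, hk, rfl⟩
    induction k with
    | zero => exact .refl
    | succ k ih =>
      exact (ih fun i hi => hk i (by omega)).tail ((h _ _).2 ⟨hk k (by omega), rfl⟩)

theorem runs_exchange (d e ρ : ℕ →₀ ℕ) : Runs (exchange d e) (ρ + d) (ρ + e) := fun τ => by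
  simp only [exchange, add_left_inj]
  exact ⟨fun ⟨_, h, h'⟩ => h ▸ h', fun h => ⟨ρ, rfl, h⟩⟩

theorem runs_add (e ρ : ℕ →₀ ℕ) : Runs (exchange 0 e) ρ (ρ + e) :=
  (runs_exchange 0 e ρ).of_eq (add_zero ρ) rfl

theorem not_exchange_single {r : ℕ} {d σ τ : ℕ →₀ ℕ} (h : σ r = 0) :
    ¬ exchange (single r 1) d σ τ := by
  rintro ⟨ρ, rfl, -⟩
  simp at h

theorem registerProgram_exchange (d e : ℕ →₀ ℕ) : RegisterProgram (exchange d e) :=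
  .base (.exchange d e)

theorem registerProgram_zeroTest (r : ℕ) : RegisterProgram (zeroTest r) := .base (.zeroTest r)

/-- The program that counts register `r` down to `0` and adds `d` in every step. -/
def transfer (r : ℕ) (d : ℕ →₀ ℕ) : (ℕ →₀ ℕ) → (ℕ →₀ ℕ) → Prop :=
  Comp (ReflTransGen (exchange (single r 1) d)) (zeroTest r)

theorem registerProgram_transfer (r : ℕ) (d : ℕ →₀ ℕ) : RegisterProgram (transfer r d) :=
  .comp (.star (registerProgram_exchange _ _)) (registerProgram_zeroTest r)

theorem runs_transfer {r : ℕ} {d ρ : ℕ →₀ ℕ} (hd : d r = 0) (hρ : ρ r = 0) (x : ℕ) :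
    Runs (transfer r d) (ρ + single r x) (ρ + x • d) := by
  let T : ℕ → (ℕ →₀ ℕ) := fun k => ρ + k • d + single r (x - k)
  have hT0 : T 0 = ρ + single r x := by simp [T]
  have hTr : ∀ k, T k r = x - k := fun k => by simp [T, hρ, hd]
  have step : ∀ k τ, exchange (single r 1) d (T k) τ ↔ k < x ∧ τ = T (k + 1) := by
    intro k τ
    rcases Nat.lt_or_ge k x with h | h
    · simp only [h, true_and]
      refine ((runs_exchange (single r 1) d (ρ + k • d + single r (x - (k + 1)))).of_eq ?_ ?_) τ
      · rw [add_assoc, ← single_add, show x - (k + 1) + 1 = x - k by omega]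
      · simp only [T, succ_nsmul]
        abel
    · simp only [not_lt.2 h, false_and, iff_false]
      exact not_exchange_single (by rw [hTr]; omega)
  intro τ
  rw [← hT0]
  simp only [transfer, Comp, reflTransGen_iff_of_forall step, CarefulSynthesis.zeroTest]
  constructor
  · rintro ⟨_, ⟨k, hk, rfl⟩, rfl, h0⟩
    rw [hTr] at h0
    rcases Nat.lt_or_ge x k with h | h
    · exact absurd (hk x h) (lt_irrefl x)
    · obtain rfl : k = x := by omega
      simp [T]
  · rintro rfl
    exact ⟨T x, ⟨x, fun _ h => h, rfl⟩, by simp [T], by simp [hTr]⟩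

/-- The program that adds register `r` to register `o`, with scratch register `t`. -/
def copy (r o t : ℕ) : (ℕ →₀ ℕ) → (ℕ →₀ ℕ) → Prop :=
  Comp (transfer r (single o 1 + single t 1)) (transfer t (single r 1))

theorem registerProgram_copy (r o t : ℕ) : RegisterProgram (copy r o t) :=
  .comp (registerProgram_transfer _ _) (registerProgram_transfer _ _)

theorem runs_copy {r o t : ℕ} {σ : ℕ →₀ ℕ} (hro : r ≠ o) (hrt : r ≠ t) (hot : o ≠ t)
    (ht : σ t = 0) : Runs (copy r o t) σ (σ + single o (σ r)) := by
  have h1 := runs_transfer (r := r) (d := single o 1 + single t 1) (ρ := σ.erase r)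
    (by simp [hro, hrt]) erase_same (σ r)
  have h2 := runs_transfer (r := t) (d := single r 1) (ρ := σ.erase r + single o (σ r))
    (by simp [hrt.symm]) (by simp [erase_ne hrt.symm, ht, hot.symm]) (σ r)
  refine ((h1.of_eq (erase_add_single r σ) ?_).comp h2).of_eq rfl ?_
  · simp [add_assoc]
  · simp only [smul_single, smul_eq_mul, mul_one]
    rw [add_right_comm, erase_add_single]

/-- The relation `F` between input vectors and outputs is computed by register programs: for all
input registers `ins` and every output register `o` below a bound `b` there is a program that adds
an output to register `o` and changes nothing else. It may use the registers from `b` on, which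
have to contain `0` in the beginning and contain `0` again in the end. -/
def Computes {n : ℕ} (F : (Fin n → ℕ) → ℕ → Prop) : Prop :=
  ∀ (ins : Fin n → ℕ) (o b : ℕ), (∀ i, ins i < b) → o < b → (∀ i, ins i ≠ o) →
    ∃ R, RegisterProgram R ∧ ∀ σ : ℕ →₀ ℕ, (∀ j, b ≤ j → σ j = 0) →
      ∀ τ, R σ τ ↔ ∃ y, F (fun i => σ (ins i)) y ∧ τ = σ + single o y

/-- The total function `f` is computed by register programs. -/
abbrev ComputesFun {n : ℕ} (f : (Fin n → ℕ) → ℕ) : Prop := Computes fun v y => y = f v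

theorem ComputesFun.exists_runs {n : ℕ} {f : (Fin n → ℕ) → ℕ} (h : ComputesFun f)
    {ins : Fin n → ℕ} {o b : ℕ} (hins : ∀ i, ins i < b) (ho : o < b) (hio : ∀ i, ins i ≠ o) :
    ∃ R, RegisterProgram R ∧ ∀ σ : ℕ →₀ ℕ, (∀ j, b ≤ j → σ j = 0) →
      Runs R σ (σ + single o (f fun i => σ (ins i))) := by
  obtain ⟨R, hR, h⟩ := h ins o b hins ho hio
  refine ⟨R, hR, fun σ hσ τ => ?_⟩
  rw [h σ hσ τ]
  simp

theorem computesFun_of_runs {n : ℕ} {f : (Fin n → ℕ) → ℕ}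
    (h : ∀ (ins : Fin n → ℕ) (o b : ℕ), (∀ i, ins i < b) → o < b → (∀ i, ins i ≠ o) →
      ∃ R, RegisterProgram R ∧ ∀ σ : ℕ →₀ ℕ, (∀ j, b ≤ j → σ j = 0) →
        Runs R σ (σ + single o (f fun i => σ (ins i)))) : ComputesFun f := by
  intro ins o b hins ho hio
  obtain ⟨R, hR, h⟩ := h ins o b hins ho hio
  refine ⟨R, hR, fun σ hσ τ => ?_⟩
  rw [h σ hσ τ]
  simp

theorem computesFun_zero {n : ℕ} : ComputesFun fun _ : Fin n → ℕ => 0 :=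
  computesFun_of_runs fun _ o _ _ _ _ =>
    ⟨_, registerProgram_exchange 0 (single o 0), fun σ _ => runs_add _ σ⟩

theorem computesFun_get {n : ℕ} (i : Fin n) : ComputesFun fun v : Fin n → ℕ => v i :=
  computesFun_of_runs fun ins o b hins ho hio =>
    ⟨_, registerProgram_copy (ins i) o b, fun _ hσ =>
      runs_copy (hio i) (hins i).ne ho.ne (hσ b le_rfl)⟩

theorem computesFun_succ : ComputesFun fun v : Fin 1 → ℕ => v 0 + 1 :=
  computesFun_of_runs fun ins o b hins ho hio =>
    ⟨_, .comp (registerProgram_copy (ins 0) o b) (registerProgram_exchange 0 (single o 1)),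
      fun σ hσ =>
      ((runs_copy (hio 0) (hins 0).ne ho.ne (hσ b le_rfl)).comp (runs_add _ _)).of_eq rfl
        (by rw [add_assoc, ← single_add])⟩

/-- The values `y 0, y 1, …` in the registers `b, b + 1, …`. -/
noncomputable def block {n : ℕ} (b : ℕ) (y : Fin n → ℕ) : ℕ →₀ ℕ :=
  ∑ i : Fin n, single (b + i) (y i)

theorem block_succ {n : ℕ} (b : ℕ) (y : Fin (n + 1) → ℕ) :
    block b y = block b (fun i => y i.castSucc) + single (b + n) (y (Fin.last n)) := by
  simp [block, Fin.sum_univ_castSucc]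

theorem block_apply_of_lt {n b j : ℕ} (y : Fin n → ℕ) (h : j < b) : block b y j = 0 := by
  rw [block, finsetSum_apply]
  exact Finset.sum_eq_zero fun i _ => single_eq_of_ne (by omega)

theorem block_apply_of_ge {n b j : ℕ} (y : Fin n → ℕ) (h : b + n ≤ j) : block b y j = 0 := by
  rw [block, finsetSum_apply]
  exact Finset.sum_eq_zero fun i _ => single_eq_of_ne (by omega)

theorem block_apply {n : ℕ} (b : ℕ) (y : Fin n → ℕ) (i : Fin n) : block b y (b + i) = y i := by
  rw [block, finsetSum_apply, Finset.sum_eq_single i]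
  · exact single_eq_same
  · exact fun j _ hj => single_eq_of_ne fun h => hj (Fin.ext (by omega))
  · simp

/-- Several values that depend on the same inputs can be computed one after the other. -/
theorem exists_program_block {m n : ℕ} {G : Fin n → (Fin m → ℕ) → ℕ → Prop}
    (hG : ∀ i, Computes (G i)) {ins : Fin m → ℕ} {b : ℕ} (hins : ∀ i, ins i < b) :
    ∃ R, RegisterProgram R ∧ ∀ σ : ℕ →₀ ℕ, (∀ j, b ≤ j → σ j = 0) → ∀ τ,
      R σ τ ↔ ∃ y : Fin n → ℕ, (∀ i, G i (fun i => σ (ins i)) (y i)) ∧ τ = σ + block b y := by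
  induction n with
  | zero =>
    refine ⟨_, registerProgram_exchange 0 0, fun σ _ τ => ?_⟩
    rw [runs_add 0 σ τ]
    exact ⟨fun h => ⟨Fin.elim0, fun i => i.elim0, by simpa [block] using h⟩,
      fun ⟨y, _, h⟩ => by simpa [block] using h⟩
  | succ n ih =>
    obtain ⟨R, hR, h⟩ := ih fun i => hG i.castSucc
    obtain ⟨R', hR', h'⟩ := hG (Fin.last n) ins (b + n) (b + n + 1)
      (fun i => (hins i).trans (by omega)) (by omega) fun i => ((hins i).trans_le (by omega)).ne
    have clean : ∀ (σ : ℕ →₀ ℕ) (y : Fin n → ℕ), (∀ j, b ≤ j → σ j = 0) →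
        ∀ j, b + n + 1 ≤ j → (σ + block b y) j = 0 := fun σ y hσ j hj => by
      rw [Finsupp.add_apply, hσ j (by omega), block_apply_of_ge y (by omega)]
    have same : ∀ (σ : ℕ →₀ ℕ) (y : Fin n → ℕ),
        (fun i => (σ + block b y) (ins i)) = fun i => σ (ins i) := fun σ y => funext fun i => by
      rw [Finsupp.add_apply, block_apply_of_lt y (hins i), add_zero]
    refine ⟨_, hR.comp hR', fun σ hσ τ => ⟨?_, ?_⟩⟩
    · rintro ⟨ρ, h1, h2⟩
      obtain ⟨y, hy, rfl⟩ := (h σ hσ ρ).1 h1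
      obtain ⟨z, hz, rfl⟩ := (h' _ (clean σ y hσ) τ).1 h2
      rw [same] at hz
      refine ⟨Fin.snoc (α := fun _ => ℕ) y z, fun i => ?_, ?_⟩
      · refine Fin.lastCases ?_ (fun i => ?_) i
        · simpa using hz
        · simpa using hy i
      · simp [block_succ, add_assoc]
    · rintro ⟨y, hy, rfl⟩
      refine ⟨_, (h σ hσ _).2 ⟨fun i => y i.castSucc, fun i => hy i.castSucc, rfl⟩,
        (h' _ (clean σ _ hσ) _).2 ⟨y (Fin.last n), ?_, ?_⟩⟩
      · rw [same]
        exact hy (Fin.last n)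
      · rw [block_succ, add_assoc]

theorem exists_program_clear_block (b n : ℕ) :
    ∃ R, RegisterProgram R ∧ ∀ σ : ℕ →₀ ℕ, (∀ j, b ≤ j → σ j = 0) → ∀ y : Fin n → ℕ,
      Runs R (σ + block b y) σ := by
  induction n with
  | zero =>
    exact ⟨_, registerProgram_exchange 0 0, fun σ _ y =>
      (runs_add 0 σ).of_eq (by simp [block]) (add_zero σ)⟩
  | succ n ih =>
    obtain ⟨R, hR, h⟩ := ih
    refine ⟨_, .comp (registerProgram_transfer (b + n) 0) hR, fun σ hσ y => ?_⟩
    have h1 := runs_transfer (r := b + n) (d := 0) (ρ := σ + block b fun i => y i.castSucc) rfl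
      (by rw [Finsupp.add_apply, hσ _ (by omega), block_apply_of_ge _ le_rfl]) (y (Fin.last n))
    exact (h1.of_eq (by rw [block_succ, add_assoc]) (by rw [smul_zero, add_zero])).comp
      (h σ hσ _)

theorem Computes.comp {m n : ℕ} {F : (Fin n → ℕ) → ℕ → Prop} {G : Fin n → (Fin m → ℕ) → ℕ → Prop}
    (hF : Computes F) (hG : ∀ i, Computes (G i)) :
    Computes fun v z => ∃ y : Fin n → ℕ, (∀ i, G i v (y i)) ∧ F y z := by
  intro ins o b hins ho hio
  obtain ⟨R₁, hR₁, h₁⟩ := exists_program_block hG hins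
  obtain ⟨R₂, hR₂, h₂⟩ := hF (fun i => b + i) o (b + n) (fun i => by omega) (by omega)
    fun i => by omega
  obtain ⟨R₃, hR₃, h₃⟩ := exists_program_clear_block b n
  have clean : ∀ (σ : ℕ →₀ ℕ) (y : Fin n → ℕ), (∀ j, b ≤ j → σ j = 0) →
      ∀ j, b + n ≤ j → (σ + block b y) j = 0 := fun σ y hσ j hj => by
    rw [Finsupp.add_apply, hσ j (by omega), block_apply_of_ge y hj]
  have read : ∀ (σ : ℕ →₀ ℕ) (y : Fin n → ℕ), (∀ j, b ≤ j → σ j = 0) →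
      (fun i : Fin n => (σ + block b y) (b + i)) = y := fun σ y hσ => funext fun i => by
    rw [Finsupp.add_apply, block_apply, hσ _ (by omega), zero_add]
  have clear : ∀ (σ : ℕ →₀ ℕ) (y : Fin n → ℕ) (z : ℕ), (∀ j, b ≤ j → σ j = 0) →
      Runs R₃ (σ + block b y + single o z) (σ + single o z) := fun σ y z hσ =>
    (h₃ (σ + single o z) (fun j hj => by
      rw [Finsupp.add_apply, hσ j hj, single_eq_of_ne (by omega), add_zero]) y).of_eq (by abel) rfl
  refine ⟨_, hR₁.comp (hR₂.comp hR₃), fun σ hσ τ => ⟨?_, ?_⟩⟩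
  · rintro ⟨ρ, e1, ρ', e2, e3⟩
    obtain ⟨y, hy, rfl⟩ := (h₁ σ hσ ρ).1 e1
    obtain ⟨z, hz, rfl⟩ := (h₂ _ (clean σ y hσ) ρ').1 e2
    rw [read σ y hσ] at hz
    exact ⟨z, ⟨y, hy, hz⟩, (clear σ y z hσ τ).1 e3⟩
  · rintro ⟨z, ⟨y, hy, hz⟩, rfl⟩
    exact ⟨_, (h₁ σ hσ _).2 ⟨y, hy, rfl⟩, _,
      (h₂ _ (clean σ y hσ) _).2 ⟨z, by rwa [read σ y hσ], rfl⟩, (clear σ y z hσ _).2 rfl⟩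

theorem ComputesFun.prec {n : ℕ} {f : (Fin n → ℕ) → ℕ} {g : (Fin (n + 2) → ℕ) → ℕ}
    (hf : ComputesFun f) (hg : ComputesFun g) :
    ComputesFun fun v : Fin (n + 1) → ℕ => Nat.rec (motive := fun _ => ℕ) (f fun i => v i.succ)
      (fun k a => g (Matrix.vecCons k (Matrix.vecCons a fun i => v i.succ))) (v 0) := by
  refine computesFun_of_runs fun ins o b hins ho hio => ?_
  -- Registers `b`, `b + 1`, `b + 2`, `b + 3` hold the number of steps done, the current value,
  -- the number of steps to do, and the next value.
  obtain ⟨Rf, hRf, h₁⟩ := hf.exists_runs (ins := fun i => ins i.succ) (o := b + 1) (b := b + 4)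
    (fun i => by have := hins i.succ; omega) (by omega) (fun i => by have := hins i.succ; omega)
  obtain ⟨Rg, hRg, h₂⟩ := hg.exists_runs
    (ins := Matrix.vecCons b (Matrix.vecCons (b + 1) fun i => ins i.succ)) (o := b + 3) (b := b + 4)
    (Fin.cases (by simp) (Fin.cases (by simp) fun i => by
      have := hins i.succ
      simp only [Matrix.cons_val_succ]
      omega)) (by omega)
    (Fin.cases (by simp) (Fin.cases (by simp) fun i => by
      have := hins i.succ
      simp only [Matrix.cons_val_succ]
      omega))
  let body := Comp (exchange (single (b + 2) 1) 0) <| Comp Rg <| Comp (transfer (b + 1) 0) <|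
    Comp (transfer (b + 3) (single (b + 1) 1)) (exchange 0 (single b 1))
  have hbody : RegisterProgram body :=
    .comp (registerProgram_exchange _ _) (.comp hRg (.comp (registerProgram_transfer _ _)
      (.comp (registerProgram_transfer _ _) (registerProgram_exchange _ _))))
  refine ⟨_, .comp hRf (.comp (registerProgram_copy (ins 0) (b + 2) (b + 3))
    (.comp (.comp (.star hbody) (registerProgram_zeroTest (b + 2)))
      (.comp (registerProgram_transfer (b + 1) (single o 1)) (registerProgram_transfer b 0)))),
    fun σ hσ => ?_⟩
  set w : Fin n → ℕ := fun i => σ (ins i.succ) with hw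
  set x := σ (ins 0) with hx
  set val : ℕ → ℕ := fun k => Nat.rec (motive := fun _ => ℕ) (f w)
      (fun k a => g (Matrix.vecCons k (Matrix.vecCons a w))) k with hval
  change Runs _ σ (σ + single o (val x))
  let T : ℕ → (ℕ →₀ ℕ) := fun k =>
    σ + single b k + single (b + 1) (val k) + single (b + 2) (x - k)
  have hb0 := hσ b le_rfl
  have hb1 := hσ (b + 1) (by omega)
  have hb2 := hσ (b + 2) (by omega)
  have hb3 := hσ (b + 3) (by omega)
  have hTr : ∀ k, T k (b + 2) = x - k := fun k => by simp [T, hb2]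
  have step : ∀ k τ, body (T k) τ ↔ k < x ∧ τ = T (k + 1) := by
    intro k τ
    rcases Nat.lt_or_ge k x with h | h
    · simp only [h, true_and]
      set ρ := σ + single b k + single (b + 2) (x - (k + 1)) with hρ
      have e1 : Runs (exchange (single (b + 2) 1) 0) (T k) (ρ + single (b + 1) (val k)) := by
        refine (runs_exchange (single (b + 2) 1) 0 (ρ + single (b + 1) (val k))).of_eq ?_
          (add_zero _)
        simp only [T, ρ, show x - k = x - (k + 1) + 1 by omega, single_add]
        abel
      have e2 := h₂ (ρ + single (b + 1) (val k)) fun j hj => by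
        simp only [ρ, Finsupp.add_apply, hσ j (by omega), single_apply]
        grind
      have hread : (fun i => (ρ + single (b + 1) (val k))
          (Matrix.vecCons b (Matrix.vecCons (b + 1) fun i => ins i.succ) i)) =
          Matrix.vecCons k (Matrix.vecCons (val k) w) := by
        funext i
        refine Fin.cases ?_ (fun i => Fin.cases ?_ (fun i => ?_) i) i
        · simp [ρ, hb0]
        · simp [ρ, hb1]
        · have := hins i.succ
          simp only [ρ, hw, Matrix.cons_val_succ, Finsupp.add_apply, single_apply]
          grind
      rw [hread, show g _ = val (k + 1) from rfl] at e2
      have e3 := runs_transfer (r := b + 1) (d := 0) (ρ := ρ + single (b + 3) (val (k + 1))) rfl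
        (by simp [ρ, hb1]) (val k)
      have e4 := runs_transfer (r := b + 3) (d := single (b + 1) 1) (ρ := ρ)
        (by simp) (by simp [ρ, hb3]) (val (k + 1))
      have e5 := runs_add (single b 1) (ρ + val (k + 1) • single (b + 1) 1)
      refine (e1.comp (e2.comp ((e3.of_eq (by abel) (by simp)).comp (e4.comp e5)))).of_eq rfl ?_ τ
      simp only [T, ρ, single_add, smul_single, smul_eq_mul, mul_one]
      abel
    · simp only [not_lt.2 h, false_and, iff_false]
      rintro ⟨ρ, h1, -⟩
      exact not_exchange_single (by rw [hTr]; omega) h1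
  have loop : Runs (Comp (ReflTransGen body) (zeroTest (b + 2))) (T 0) (T x) := by
    intro τ
    simp only [Comp, reflTransGen_iff_of_forall step, CarefulSynthesis.zeroTest]
    constructor
    · rintro ⟨_, ⟨k, hk, rfl⟩, rfl, h0⟩
      rw [hTr] at h0
      rcases Nat.lt_or_ge x k with h | h
      · exact absurd (hk x h) (lt_irrefl x)
      · obtain rfl : k = x := by omega
        rfl
    · rintro rfl
      exact ⟨T x, ⟨x, fun _ h => h, rfl⟩, rfl, by simp [hTr]⟩
  have s1 : Runs Rf σ (σ + single (b + 1) (val 0)) := h₁ σ fun j hj => hσ j (by omega)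
  have hins0 := hins 0
  have s2 : Runs (copy (ins 0) (b + 2) (b + 3)) (σ + single (b + 1) (val 0)) (T 0) := by
    refine (runs_copy (by omega) (by omega) (by omega) ?_).of_eq rfl ?_
    · simp [hb3]
    · have : (σ + single (b + 1) (val 0)) (ins 0) = x := by
        rw [Finsupp.add_apply, single_eq_of_ne (by omega), add_zero]
      rw [this]
      simp [T]
  have s4 := runs_transfer (r := b + 1) (d := single o 1) (ρ := σ + single b x)
    (single_eq_of_ne (by omega)) (by simp [hb1]) (val x)
  have s5 := runs_transfer (r := b) (d := 0) (ρ := σ + single o (val x)) rfl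
    (by rw [Finsupp.add_apply, hb0, single_eq_of_ne (by omega), add_zero]) x
  refine s1.comp (s2.comp (loop.comp ((s4.of_eq ?_ ?_).comp (s5.of_eq rfl (by simp)))))
  · simp [T]
  · simp only [smul_single, smul_eq_mul, mul_one]
    abel

/-- Unbounded search. If no zero of `f` is found, then the program has no final state. -/
theorem ComputesFun.rfind {n : ℕ} {f : (Fin (n + 1) → ℕ) → ℕ} (hf : ComputesFun f) :
    Computes fun (v : Fin n → ℕ) k =>
      (∀ i < k, f (Matrix.vecCons i v) ≠ 0) ∧ f (Matrix.vecCons k v) = 0 := by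
  intro ins o b hins ho hio
  -- Register `b` holds the current candidate, register `b + 1` the value of `f` there.
  obtain ⟨Rf, hRf, h₁⟩ := hf.exists_runs (ins := Matrix.vecCons b ins) (o := b + 1) (b := b + 2)
    (Fin.cases (by simp) fun i => by have := hins i; simp only [Matrix.cons_val_succ]; omega)
    (by omega)
    (Fin.cases (by simp) fun i => by have := hins i; simp only [Matrix.cons_val_succ]; omega)
  let body := Comp Rf <| Comp (exchange (single (b + 1) 1) 0) <| Comp (transfer (b + 1) 0)
    (exchange 0 (single b 1))
  have hbody : RegisterProgram body :=
    .comp hRf (.comp (registerProgram_exchange _ _)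
      (.comp (registerProgram_transfer _ _) (registerProgram_exchange _ _)))
  refine ⟨_, .comp (.star hbody) (.comp hRf (.comp (registerProgram_zeroTest (b + 1))
    (registerProgram_transfer b (single o 1)))), fun σ hσ τ => ?_⟩
  set v : Fin n → ℕ := fun i => σ (ins i) with hv
  set val : ℕ → ℕ := fun k => f (Matrix.vecCons k v) with hval
  let T : ℕ → (ℕ →₀ ℕ) := fun k => σ + single b k
  have hb0 := hσ b le_rfl
  have hb1 := hσ (b + 1) (by omega)
  have hT1 : ∀ k, T k (b + 1) = 0 := fun k => by simp [T, hb1]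
  have hT0 : T 0 = σ := by simp [T]
  have eval : ∀ k, Runs Rf (T k) (T k + single (b + 1) (val k)) := by
    intro k
    have e := h₁ (T k) fun j hj => by
      simp only [T, Finsupp.add_apply, hσ j (by omega), single_apply]
      grind
    have hread : (fun i => T k (Matrix.vecCons b ins i)) = Matrix.vecCons k v := by
      funext i
      refine Fin.cases ?_ (fun i => ?_) i
      · simp [T, hb0]
      · have := hins i
        simp only [T, hv, Matrix.cons_val_succ, Finsupp.add_apply, single_apply]
        grind
    rwa [hread] at e
  have step : ∀ k τ, body (T k) τ ↔ val k ≠ 0 ∧ τ = T (k + 1) := by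
    intro k τ
    rcases Nat.eq_zero_or_pos (val k) with h | h
    · simp only [h, ne_eq, not_true_eq_false, false_and, iff_false]
      rintro ⟨ρ, h1, ρ', h2, -⟩
      rw [eval k ρ] at h1
      exact not_exchange_single (by simp [h1, h, hT1]) h2
    · simp only [ne_eq, h.ne', not_false_eq_true, true_and]
      have e2 := runs_exchange (single (b + 1) 1) 0 (T k + single (b + 1) (val k - 1))
      have e3 := runs_transfer (r := b + 1) (d := 0) (ρ := T k) rfl (hT1 k) (val k - 1)
      have e4 := runs_add (single b 1) (T k)
      refine ((eval k).comp ((e2.of_eq ?_ (add_zero _)).comp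
        ((e3.of_eq rfl (by simp)).comp e4))).of_eq rfl ?_ τ
      · rw [add_assoc, ← single_add, Nat.sub_add_cancel h]
      · simp only [T, single_add]
        abel
  have last : ∀ k, Runs (transfer b (single o 1)) (T k) (σ + single o k) := fun k =>
    (runs_transfer (r := b) (d := single o 1) (ρ := σ) (single_eq_of_ne (by omega)) hb0 k).of_eq rfl
      (by simp)
  constructor
  · rintro ⟨ρ, h1, ρ₂, h2, ρ₃, ⟨rfl, h3⟩, h4⟩
    rw [← hT0, reflTransGen_iff_of_forall step] at h1
    obtain ⟨k, hk, rfl⟩ := h1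
    obtain rfl := (eval k _).1 h2
    have hz : val k = 0 := by simpa [hT1] using h3
    rw [hz, single_zero, add_zero] at h4
    exact ⟨k, ⟨hk, hz⟩, (last k τ).1 h4⟩
  · rintro ⟨k, ⟨hk, hz⟩, rfl⟩
    change val k = 0 at hz
    have hev := eval k
    rw [hz, single_zero, add_zero] at hev
    refine ⟨T k, ?_, T k, (hev _).2 rfl, T k, ⟨rfl, hT1 k⟩, (last k _).2 rfl⟩
    rw [← hT0, reflTransGen_iff_of_forall step]
    exact ⟨k, hk, rfl⟩

theorem ofFn_vecCons {n : ℕ} (a : ℕ) (v : Fin n → ℕ) :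
    List.Vector.ofFn (Matrix.vecCons a v) = a ::ᵥ List.Vector.ofFn v := rfl

theorem computesFun_of_primrec {n : ℕ} {f : List.Vector ℕ n → ℕ} (hf : Nat.Primrec' f) :
    ComputesFun fun v => f (List.Vector.ofFn v) := by
  induction hf with
  | zero => exact computesFun_zero
  | succ => exact computesFun_succ
  | get i => simpa using computesFun_get i
  | @comp m n f g _ _ ihf ihg =>
    have := Computes.comp ihf ihg
    simpa only [← funext_iff, exists_eq_left] using this
  | @prec n f g _ _ ihf ihg => exact ihf.prec ihg

theorem mem_mOfFn_iff {n : ℕ} {f : Fin n → Part ℕ} {v : List.Vector ℕ n} :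
    v ∈ List.Vector.mOfFn f ↔ ∀ i, v.get i ∈ f i := by
  induction n with
  | zero => simp [List.Vector.mOfFn, List.Vector.eq_nil v]
  | succ n ih =>
    simp only [List.Vector.mOfFn, Part.bind_eq_bind, Part.pure_eq_some, Part.mem_bind_iff,
      Part.mem_some_iff, ih, Fin.forall_fin_succ]
    constructor
    · rintro ⟨a, ha, w, hw, rfl⟩
      simpa using ⟨ha, hw⟩
    · rintro ⟨h0, h1⟩
      exact ⟨v.get 0, h0, v.tail, by simpa using h1, by simp⟩

theorem computes_of_partrec {n : ℕ} {f : List.Vector ℕ n →. ℕ} (hf : Nat.Partrec' f) :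
    Computes fun v y => y ∈ f (List.Vector.ofFn v) := by
  induction hf with
  | prim hf => simpa using computesFun_of_primrec hf
  | @comp m n f g _ _ ihf ihg =>
    refine (congrArg Computes (funext₂ fun v z => propext ?_)).mpr (Computes.comp ihf ihg)
    refine Part.mem_bind_iff.trans ⟨?_, ?_⟩
    · rintro ⟨y, hy, hz⟩
      exact ⟨y.get, mem_mOfFn_iff.1 hy, by rwa [List.Vector.ofFn_get]⟩
    · rintro ⟨y, hy, hz⟩
      refine ⟨List.Vector.ofFn y, mem_mOfFn_iff.2 fun i => ?_, hz⟩
      rw [List.Vector.get_ofFn]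
      exact hy i
  | @rfind n f _ ih =>
    have h : ComputesFun fun v => f (List.Vector.ofFn v) := by simpa using ih
    refine (congrArg Computes (funext₂ fun v k => propext ?_)).mpr h.rfind
    refine Nat.mem_rfind.trans ?_
    simp [ofFn_vecCons, and_comm]

end CarefulSynthesis

namespace CarefulSynthesis

open Relation

/-! ### The instance of an automaton with counters -/

/-- The states of the arena that simulates an automaton with state set `Q`. -/
inductive Node (Q : Type) where
  | init
  | halt
  | trap
  | state (q : Q)

instance {Q : Type} [Finite Q] : Finite (Node Q) := by
  refine Finite.of_surjective (α := Fin 3 ⊕ Q)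
    (Sum.elim ![Node.init, Node.halt, Node.trap] Node.state) ?_
  rintro (_ | _ | _ | q)
  exacts [⟨.inl 0, rfl⟩, ⟨.inl 1, rfl⟩, ⟨.inl 2, rfl⟩, ⟨.inr q, rfl⟩]

namespace Automaton

variable (A : Automaton)

/-- The zero test that a node claims to be passed. -/
def nodeTest : Node A.Q → Option (Fin 2)
  | .state q => (A.act q).test
  | _ => none

/-- The edges of the arena that simulates an automaton. Every state of the automaton has an edge to
`trap`, which makes sure that there are no dead ends. -/
def nodeEdge : Node A.Q → Node A.Q → Prop
  | .init, .state q => q = A.start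
  | .state q, .state q' => A.edge q q'
  | .state q, .halt => q = A.final
  | .state _, .trap => True
  | .halt, .halt => True
  | .trap, .trap => True
  | _, _ => False

/-- The costs of the edges of the arena: the first edge loads the number `x` into the first counter,
and an edge to `trap` costs one unit of the counter that is tested for zero. -/
def nodeCost (x : ℕ) : Node A.Q → Node A.Q → Fin 2 → ℤ
  | .init, .state _ => ![x, 0]
  | .state q, .trap => (A.act q).test.elim 0 fun r => -Pi.single r 1
  | .state q, _ => (A.act q).add
  | _, _ => 0

/-- The propositions `0` and `1` mark the nodes `halt` and `trap`. -/
def nodeLabel : Node A.Q → Finset ℕ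
  | .halt => {0}
  | .trap => {1}
  | _ => ∅

theorem exists_nodeEdge : ∀ u, ∃ v, A.nodeEdge u v
  | .init => ⟨.state A.start, rfl⟩
  | .halt => ⟨.halt, trivial⟩
  | .trap => ⟨.trap, trivial⟩
  | .state _ => ⟨.trap, trivial⟩

/-- A numbering of the nodes. -/
noncomputable def nodeEquiv : Node A.Q ≃ Fin (Nat.card (Node A.Q)) :=
  letI := A.fintype
  Finite.equivFin _

open Classical in
/-- The instance that simulates the automaton `A` with the number `x` in the first counter. -/
noncomputable def toInstance (x : ℕ) : Instance 2 2 where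
  N := Nat.card (Node A.Q)
  init := A.nodeEquiv .init
  owner s := if (A.nodeTest (A.nodeEquiv.symm s)).isSome then 1 else 0
  edge s t := decide (A.nodeEdge (A.nodeEquiv.symm s) (A.nodeEquiv.symm t))
  serial s := by
    obtain ⟨v, hv⟩ := A.exists_nodeEdge (A.nodeEquiv.symm s)
    exact ⟨A.nodeEquiv v, by simpa using hv⟩
  label s := A.nodeLabel (A.nodeEquiv.symm s)
  cost s t := A.nodeCost x (A.nodeEquiv.symm s) (A.nodeEquiv.symm t)
  obj := ![.eventually (.atom 0), .eventually (.atom 1)]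
  spec := .eventually (.atom 0)

theorem toInstance_reachabilityObjectives (x : ℕ) : (A.toInstance x).ReachabilityObjectives :=
  ⟨Fin.forall_fin_two.2 ⟨⟨0, rfl⟩, ⟨1, rfl⟩⟩, ⟨0, rfl⟩⟩

theorem toInstance_edge (x : ℕ) (u v : Node A.Q) :
    (A.toInstance x).arena.edge (A.nodeEquiv u) (A.nodeEquiv v) ↔ A.nodeEdge u v := by
  simp [Instance.arena, toInstance]

theorem toInstance_cost (x : ℕ) (u v : Node A.Q) :
    (A.toInstance x).cost (A.nodeEquiv u) (A.nodeEquiv v) = A.nodeCost x u v := by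
  simp [toInstance]

theorem toInstance_owner (x : ℕ) (u : Node A.Q) :
    (A.toInstance x).arena.owner (A.nodeEquiv u) = 1 ↔ ∃ r, A.nodeTest u = some r := by
  cases h : A.nodeTest u <;> simp [Instance.arena, toInstance, h]

/-- The arena of an automaton checks the zero tests of the automaton by deviations. -/
noncomputable def counterGame (x : ℕ) :
    CounterGame (A.toInstance x).arena (A.toInstance x).cost where
  halt := A.nodeEquiv .halt
  trap := A.nodeEquiv .trap
  test s := A.nodeTest (A.nodeEquiv.symm s)
  halt_edge t h := by
    obtain ⟨v, rfl⟩ := A.nodeEquiv.surjective t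
    rw [toInstance_edge] at h
    cases v <;> first | rfl | exact h.elim
  trap_edge t h := by
    obtain ⟨v, rfl⟩ := A.nodeEquiv.surjective t
    rw [toInstance_edge] at h
    cases v <;> first | rfl | exact h.elim
  halt_cost := A.toInstance_cost x .halt .halt
  trap_cost := A.toInstance_cost x .trap .trap
  halt_ne_trap h := by cases A.nodeEquiv.injective h
  init_ne_trap h := by cases A.nodeEquiv.injective h
  test_of_owner s _ h := by
    obtain ⟨u, rfl⟩ := A.nodeEquiv.surjective s
    rw [toInstance_owner] at h
    simpa using h
  owner_of_test s r h := by
    obtain ⟨u, rfl⟩ := A.nodeEquiv.surjective s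
    rw [toInstance_owner]
    exact ⟨r, by simpa using h⟩
  edge_of_test s r h := by
    obtain ⟨u, rfl⟩ := A.nodeEquiv.surjective s
    rw [Equiv.symm_apply_apply] at h
    rw [toInstance_edge]
    cases u with
    | state q => trivial
    | _ => cases h
  cost_of_test s r h := by
    obtain ⟨u, rfl⟩ := A.nodeEquiv.surjective s
    rw [Equiv.symm_apply_apply] at h
    rw [toInstance_cost]
    cases u with
    | state q =>
      change (A.act q).test = some r at h
      simp [nodeCost, h]
    | _ => cases h
  eq_of_test s r t t' h h1 h2 h3 h4 := by
    obtain ⟨u, rfl⟩ := A.nodeEquiv.surjective s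
    obtain ⟨v, rfl⟩ := A.nodeEquiv.surjective t
    obtain ⟨v', rfl⟩ := A.nodeEquiv.surjective t'
    rw [Equiv.symm_apply_apply] at h
    rw [toInstance_edge] at h1 h2
    cases u with
    | state q =>
      change (A.act q).test = some r at h
      have hq : q ≠ A.final := fun hq => A.test_final r (hq ▸ h)
      have hv : ∀ w, A.nodeEdge (.state q) w → A.nodeEquiv w ≠ A.nodeEquiv .trap →
          ∃ q', w = .state q' ∧ A.edge q q' := by
        rintro (_ | _ | _ | q') hw hne
        · exact hw.elim
        · exact absurd hw hq
        · exact absurd rfl hne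
        · exact ⟨q', rfl, hw⟩
      obtain ⟨q₁, rfl, e₁⟩ := hv v h1 h3
      obtain ⟨q₂, rfl, e₂⟩ := hv v' h2 h4
      rw [A.eq_of_test q r h q₁ q₂ e₁ e₂]
    | _ => cases h

theorem sat_eventually_iff {S AP : Type} {label : S → Set AP} {a : AP} {ρ : ℕ → S} :
    (LTL.eventually (.atom a)).Sat label ρ ↔ ∃ k, a ∈ label (ρ k) := by
  simp [LTL.eventually, LTL.Sat, Classical.em]

theorem toInstance_objective (x a : ℕ) (u : Node A.Q) (h : ∀ v, a ∈ A.nodeLabel v ↔ v = u) :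
    (A.toInstance x).objective (.eventually (.atom a)) =
      {π | π ∈ (A.toInstance x).arena.plays ∧ ∃ k, π k = A.nodeEquiv u} := by
  ext π
  have hl : ∀ s, a ∈ (A.toInstance x).arena.label s ↔ s = A.nodeEquiv u := fun s => by
    refine Iff.trans ?_ A.nodeEquiv.symm_apply_eq
    rw [← h]
    rfl
  simp only [Instance.objective, Set.mem_ofPred_eq, sat_eventually_iff, hl]

theorem toInstance_hasSolution_iff (x : ℕ) :
    (A.toInstance x).HasSolution ↔ ∃ c, A.Reaches ![x, 0] c := by
  have h0 := A.toInstance_objective x 0 .halt (by rintro (_ | _ | _ | q) <;> simp [nodeLabel])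
  have h1 := A.toInstance_objective x 1 .trap (by rintro (_ | _ | _ | q) <;> simp [nodeLabel])
  refine ((A.counterGame x).exists_isSolution_iff h0 h1 h0).trans (exists_congr fun c => ?_)
  change ReflTransGen _ (A.nodeEquiv .init, 0) (A.nodeEquiv .halt, c) ↔ _
  have move_iff : ∀ u v c c', (A.counterGame x).Move (A.nodeEquiv u, c) (A.nodeEquiv v, c') ↔
      A.nodeEdge u v ∧ v ≠ .trap ∧ (∀ r, A.nodeTest u = some r → c r = 0) ∧
        ∀ r, (c' r : ℤ) = c r + A.nodeCost x u v r := by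
    intro u v c c'
    have htest : ∀ r, (A.counterGame x).test (A.nodeEquiv u) = some r ↔ A.nodeTest u = some r :=
      fun r => by simp [counterGame]
    have htrap : A.nodeEquiv v ≠ (A.counterGame x).trap ↔ v ≠ .trap :=
      A.nodeEquiv.injective.ne_iff
    rw [CounterGame.Move, toInstance_edge, toInstance_cost]
    simp only [htest]
    exact and_congr_right' (and_congr_left' htrap)
  constructor
  · intro h
    suffices H : ∀ y, ReflTransGen (A.counterGame x).Move (A.nodeEquiv .init, 0) y →
        (y.1 = A.nodeEquiv .init ∧ y.2 = 0) ∨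
        (∃ q, y.1 = A.nodeEquiv (.state q) ∧ ReflTransGen A.Step (A.start, ![x, 0]) (q, y.2)) ∨
        (y.1 = A.nodeEquiv .halt ∧ A.Reaches ![x, 0] y.2) by
      obtain ⟨h, -⟩ | ⟨q, h, -⟩ | ⟨-, h⟩ := H _ h
      · cases A.nodeEquiv.injective h
      · cases A.nodeEquiv.injective h
      · exact h
    intro y h
    induction h with
    | refl => exact .inl ⟨rfl, rfl⟩
    | @tail y z _ h2 ih =>
      obtain ⟨s, d⟩ := y
      obtain ⟨t, d'⟩ := z
      obtain ⟨v, rfl⟩ := A.nodeEquiv.surjective t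
      obtain ⟨rfl, rfl⟩ | ⟨q, rfl, h⟩ | ⟨rfl, h⟩ := ih
      · obtain ⟨e1, -, -, e2⟩ := (move_iff _ _ _ _).1 h2
        cases v with
        | state q =>
          cases e1
          have hd : d' = ![x, 0] := funext fun r => by
            have := e2 r
            fin_cases r <;> simpa [nodeCost] using this
          exact .inr (.inl ⟨_, rfl, hd ▸ .refl⟩)
        | _ => exact e1.elim
      · obtain ⟨e1, e2, e3, e4⟩ := (move_iff _ _ _ _).1 h2
        cases v with
        | init => exact e1.elim
        | trap => exact absurd rfl e2
        | state q' => exact .inr (.inl ⟨q', rfl, h.tail ⟨e1, e3, e4⟩⟩)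
        | halt =>
          cases e1
          have hd : d' = d := Act.rel_skip.1 (A.act_final ▸ ⟨e3, e4⟩)
          exact .inr (.inr ⟨rfl, hd ▸ h⟩)
      · obtain ⟨e1, -⟩ := (move_iff _ _ _ _).1 h2
        cases v with
        | halt =>
          have hd : d' = d := funext fun r => by
            simpa [nodeCost] using ((move_iff _ _ _ _).1 h2).2.2.2 r
          exact .inr (.inr ⟨rfl, hd ▸ h⟩)
        | _ => exact e1.elim
  · intro h
    have e1 : (A.counterGame x).Move (A.nodeEquiv .init, 0)
        (A.nodeEquiv (.state A.start), ![x, 0]) := by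
      rw [move_iff]
      refine ⟨rfl, nofun, nofun, fun r => ?_⟩
      fin_cases r <;> simp [nodeCost]
    have e2 : ReflTransGen (A.counterGame x).Move (A.nodeEquiv (.state A.start), ![x, 0])
        (A.nodeEquiv (.state A.final), c) :=
      ReflTransGen.lift (r := A.Step) (p := (A.counterGame x).Move)
        (fun y => (A.nodeEquiv (.state y.1), y.2))
        (fun y z h => (move_iff _ _ _ _).2 ⟨h.1, nofun, h.2.1, h.2.2⟩) _ _ h
    have e3 : (A.counterGame x).Move (A.nodeEquiv (.state A.final), c) (A.nodeEquiv .halt, c) := by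
      rw [move_iff]
      exact ⟨rfl, nofun, fun r hr => absurd hr (A.test_final r),
        fun r => by simp [nodeCost, A.act_final, Act.skip]⟩
    exact (e2.tail e3).head e1

end Automaton

/-! ### Undecidability -/

theorem primrec_natCast_int : Primrec fun n : ℕ => (n : ℤ) :=
  Primrec.encode_iff.1 ((Primrec.nat_mul.comp (.const 2) .id).of_eq fun _ => rfl)

theorem primrec_two_pow : Primrec fun n : ℕ => 2 ^ n :=
  (Primrec.nat_iff.2 (Nat.Primrec.pow.comp ((Nat.Primrec.const 2).pair Nat.Primrec.id))).of_eq
    fun n => by simp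

/-- Only the cost of the first edge depends on `n`, so the description is computable although the
automaton is arbitrary. -/
theorem Automaton.computable_describe (A : Automaton) :
    Computable fun n : ℕ => (A.toInstance (2 ^ n)).describe := by
  have hcost : ∀ u v r, Computable fun n : ℕ => A.nodeCost (2 ^ n) u v r := by
    intro u v r
    cases u with
    | init =>
      cases v with
      | state q =>
        fin_cases r
        · exact (primrec_natCast_int.comp primrec_two_pow).to_comp
        · exact .const 0
      | _ => exact .const _
    | state q => cases v <;> exact .const _
    | _ => exact .const _
  refine Computable.of_eq (f := fun n => ((2, 2, Nat.card (Node A.Q), (A.nodeEquiv .init).val,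
    List.ofFn fun s => ((A.toInstance 0).owner s).val,
    List.ofFn fun s => ((A.toInstance 0).label s).sort (· ≤ ·),
    List.ofFn fun s => List.ofFn fun t => ((A.toInstance 0).edge s t,
      List.ofFn (A.nodeCost (2 ^ n) (A.nodeEquiv.symm s) (A.nodeEquiv.symm t))),
    List.ofFn fun i => ((A.toInstance 0).obj i).code, (A.toInstance 0).spec.code) : Description)) ?_
    fun n => rfl
  exact (Computable.const _).pair <| (Computable.const _).pair <| (Computable.const _).pair <|
    (Computable.const _).pair <| (Computable.const _).pair <| (Computable.const _).pair <|
    (Computable.list_ofFn fun s => Computable.list_ofFn fun t => (Computable.const _).pair <|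
      Computable.list_ofFn fun r => hcost _ _ r).pair <| (Computable.const _).pair <|
    Computable.const _

/-- There is an automaton that accepts the first counter value `2 ^ n` exactly if the `n`-th program
halts on input `0`. -/
theorem exists_universal_automaton : ∃ A : Automaton, ∀ c : Nat.Partrec.Code,
    (∃ d, A.Reaches ![2 ^ Encodable.encode c, 0] d) ↔ (c.eval 0).Dom := by
  let f : ℕ →. ℕ := fun n => (Denumerable.ofNat Nat.Partrec.Code n).eval 0
  have hf : Partrec f := Nat.Partrec.Code.eval_part.comp (Computable.ofNat _) (.const 0)
  obtain ⟨R, hR, h⟩ := computes_of_partrec (Nat.Partrec'.part_iff₁.2 hf) (fun _ => 0) 1 2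
    (fun _ => by omega) (by omega) (fun _ => by omega)
  obtain ⟨R', hR', hs⟩ := hR.exists_simulates
  obtain ⟨A, rfl⟩ := hR'.exists_automaton
  refine ⟨A, fun c => ?_⟩
  have hcode : registerCode (Finsupp.single 0 (Encodable.encode c)) = 2 ^ Encodable.encode c := by
    rw [registerCode_single, Nat.nth_prime_zero_eq_two]
  have h' := h (Finsupp.single 0 (Encodable.encode c)) fun j hj =>
    Finsupp.single_eq_of_ne (by omega)
  have hs' := hs (Finsupp.single 0 (Encodable.encode c))
  simp only [hcode] at hs'
  simp only [hs', h', Part.dom_iff_mem]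
  have hv : (List.Vector.ofFn fun _ : Fin 1 =>
      Finsupp.single (0 : ℕ) (Encodable.encode c) 0).head = Encodable.encode c := by
    simp
  have hfc : f (Encodable.encode c) = c.eval 0 := by simp [f]
  constructor
  · rintro ⟨d, τ, -, y, hy, -⟩
    exact ⟨y, by rwa [hv, hfc] at hy⟩
  · rintro ⟨y, hy⟩
    exact ⟨_, _, rfl, y, by rwa [hv, hfc], rfl⟩

theorem not_decidableProblem_reachability :
    ¬ DecidableProblem (fun I : {I : Instance 2 2 // I.ReachabilityObjectives} => I.1.describe)
      (fun I => I.1.HasSolution) := by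
  rintro ⟨f, hf, h⟩
  obtain ⟨A, hA⟩ := exists_universal_automaton
  refine ComputablePred.halting_problem 0 (ComputablePred.computable_iff.2
    ⟨fun c => f (A.toInstance (2 ^ Encodable.encode c)).describe,
      hf.comp (A.computable_describe.comp Computable.encode), funext fun c => propext ?_⟩)
  exact ((hA c).symm.trans (A.toInstance_hasSolution_iff _).symm).trans
    (h ⟨_, A.toInstance_reachabilityObjectives _⟩).symm

end CarefulSynthesis

theorem mainTheorem1 :
    (¬ CarefulSynthesis.DecidableProblem
      (fun I : (n : ℕ) × (d : ℕ) × CarefulSynthesis.Instance n d => I.2.2.describe)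
      (fun I => I.2.2.HasSolution)) ∧
    (¬ CarefulSynthesis.DecidableProblem
      (fun I : {I : CarefulSynthesis.Instance 2 2 // I.ReachabilityObjectives} => I.1.describe)
      (fun I => I.1.HasSolution)) := by
  refine ⟨?_, CarefulSynthesis.not_decidableProblem_reachability⟩
  rintro ⟨f, hf, h⟩
  exact CarefulSynthesis.not_decidableProblem_reachability ⟨f, hf, fun I => h ⟨2, 2, I.1⟩⟩
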